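/- Let $N\ge 1$ and let $U$ be a Haar-distributed random unitary in $\mathsf U(2N)$, acting on $\mathbb C^2\otimes\mathbb C^N$ (one ancilla qubit, $M=2$). Let $A\in\mathbb C^{N\times N}$ be its upper-left $N\times N$ block (so that $U$ is a $1$-block-encoding of $A$), and let $\lambda_1,\dots,\lambda_N$ be the eigenvalues, with multiplicity and labeled in uniformly random order, of $A^\dagger A$. For $M\ge 2$ let $w(x)=(1-x)^{N(M-2)}$ and $(f,g)_w=\int_0^1 f(x)g(x)w(x)\,\mathrm dx$. For monic polynomials $C_0,\dots,C_{N-1}$ with $\deg C_i=i$ that are pairwise orthogonal with respect to $(\cdot,\cdot)_w$, let $$K(x,y)=w(x)\sum_{i=0}^{N-1}\frac{1}{c_i}C_i(x)C_i(y),\qquad c_i=(C_i,C_i)_w .$$ Then, for $M=2$: the weight is constant, $w\equiv 1$; polynomials $C_0,\dots,C_{N-1}$ as above exist, and for every such choice $$K(x,y)=\sum_{i=0}^{N-1}(2i+1)\,P_i(2x-1)\,P_i(2y-1)\qquad(x,y\in\mathbb R),$$ where $P_i$ is the $i$-th Legendre polynomial. Moreover, the joint eigenvalue distribution is determinantal with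 this kernel: for every $0\le\ell\le N$, the joint law of $(\lambda_1,\dots,\lambda_\ell)$ is supported in $[0,1]^\ell$ and has there, with respect to Lebesgue measure, the nonnegative density $$\mathbb P^{(\ell)}_{\mathrm{eig}}(x_1,\dots,x_\ell)=\frac{(N-\ell)!}{N!}\det\bigl[K(x_j,x_k)\bigr]_{j,k=1}^{\ell}.$$ -/

import Mathlib

open MeasureTheory Polynomial
open scoped ENNReal Nat

noncomputable section

namespace BlockEncoding

/-- The unitary group carries its Borel `σ`-algebra. -/
instance instMeasurableSpaceUnitaryGroup (ι : Type*) [Fintype ι] [DecidableEq ι] :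
    MeasurableSpace (Matrix.unitaryGroup ι ℂ) := borel _

instance instBorelSpaceUnitaryGroup (ι : Type*) [Fintype ι] [DecidableEq ι] :
    BorelSpace (Matrix.unitaryGroup ι ℂ) := ⟨rfl⟩

/-- The matrix `A` block encoded in the unitary `U` acting on `ℂ^M ⊗ ℂ^N` (ancilla register first):
its upper left `N × N` block, where the ancilla register is in the state `0`. -/
def block {M N : ℕ} [NeZero M] (U : Matrix.unitaryGroup (Fin M × Fin N) ℂ) :
    Matrix (Fin N) (Fin N) ℂ :=
  (U : Matrix (Fin M × Fin N) (Fin M × Fin N) ℂ).submatrix (fun i => (0, i)) (fun j => (0, j))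

/-- The eigenvalues (with multiplicity, in decreasing order up to a fixed relabeling of the
index set) of the Hermitian matrix `A† A`, with `A` the matrix block encoded in `U`. -/
def eigenvalues {M N : ℕ} [NeZero M] (U : Matrix.unitaryGroup (Fin M × Fin N) ℂ) : Fin N → ℝ :=
  (Matrix.isHermitian_conjTranspose_mul_self (block U)).eigenvalues

/-- The joint law of all eigenvalues of `A† A`, labeled in uniformly random order, when the
unitary is drawn from `μ`. -/
def eigenvalueLaw {M N : ℕ} [NeZero M] (μ : Measure (Matrix.unitaryGroup (Fin M × Fin N) ℂ)) :
    Measure (Fin N → ℝ) :=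
  (N ! : ℝ≥0∞)⁻¹ • ∑ π : Equiv.Perm (Fin N), μ.map (fun U i => eigenvalues U (π i))

/-- The joint law of `ℓ` eigenvalues: the marginal of `eigenvalueLaw` on the first `ℓ`
coordinates. -/
def eigenvalueMarginal {M N : ℕ} [NeZero M]
    (μ : Measure (Matrix.unitaryGroup (Fin M × Fin N) ℂ)) {ℓ : ℕ} (hℓ : ℓ ≤ N) :
    Measure (Fin ℓ → ℝ) :=
  (eigenvalueLaw μ).map (fun x i => x (Fin.castLE hℓ i))

/-- The weight function `w(x) = (1 - x)^{N (M - 2)}`. -/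
def weight (N M : ℕ) (x : ℝ) : ℝ := (1 - x) ^ ((N : ℤ) * ((M : ℤ) - 2))

/-- The weighted inner product `(f, g)_w = ∫₀¹ f g w` of two polynomials. -/
def weightedInner (w : ℝ → ℝ) (f g : ℝ[X]) : ℝ :=
  ∫ x in (0 : ℝ)..1, f.eval x * g.eval x * w x

/-- `C 0, …, C (N - 1)` are monic polynomials with `deg (C i) = i`, pairwise orthogonal with
respect to `(·, ·)_w`. -/
structure IsMonicOrthogonal (w : ℝ → ℝ) {N : ℕ} (C : Fin N → ℝ[X]) : Prop where
  monic : ∀ i, (C i).Monic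
  natDegree_eq : ∀ i, (C i).natDegree = i
  orthogonal : ∀ i j, i ≠ j → weightedInner w (C i) (C j) = 0

/-- The kernel `w(x) ∑ᵢ Cᵢ(x) Cᵢ(y) / cᵢ`, with `cᵢ = (Cᵢ, Cᵢ)_w`. -/
def kernel (w : ℝ → ℝ) {N : ℕ} (C : Fin N → ℝ[X]) (x y : ℝ) : ℝ :=
  w x * ∑ i, 1 / weightedInner w (C i) (C i) * (C i).eval x * (C i).eval y

/-- The `n`-th Legendre polynomial, by Rodrigues' formula. -/
def legendre (n : ℕ) : ℝ[X] :=
  Polynomial.C (1 / ((2 : ℝ) ^ n * (n ! : ℝ))) * derivative^[n] ((X ^ 2 - 1) ^ n)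

/-- `∑_{i < N} (2i + 1) Pᵢ(2x - 1) Pᵢ(2y - 1)`. -/
def legendreKernel (N : ℕ) (x y : ℝ) : ℝ :=
  ∑ i ∈ Finset.range N,
    (2 * (i : ℝ) + 1) * (legendre i).eval (2 * x - 1) * (legendre i).eval (2 * y - 1)

/-- The determinantal `ℓ`-point function `((N - ℓ)! / N!) det [K(λⱼ, λₖ)]`, for `ℓ ≤ N`. -/
def determinantalDensity (N : ℕ) (K : ℝ → ℝ → ℝ) {ℓ : ℕ} (x : Fin ℓ → ℝ) : ℝ :=
  (((N - ℓ)! : ℕ) : ℝ) / (N ! : ℝ) * (Matrix.of fun j k => K (x j) (x k)).det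

end BlockEncoding

end

/-! Both laws live on the cube [0,1]^N, so polynomial integrals determine them. Both are
exchangeable, so symmetric polynomials suffice. The two laws are compared there through a common
family of Schwinger–Dyson (loop) equations, without a Jacobian for the singular value decomposition.

Write p(z) = ∏ᵢ (z - xᵢ). The equations say that, for every symmetric f, the expectation of f ·
(z(1-z)p'' + (1-2z)p' + N(N+1)p) + ∑ᵢ ∂ᵢf · xᵢ(1-xᵢ) · p(z)/(z-xᵢ) vanishes identically in z
(`sdPoly`, with coefficients `sdCoeff`). The factor of f is the shifted Legendre operator applied to
p.

Uniqueness (`eq_zero_of_sdCoeff`): the coefficient of z^k expresses the expectation of f times the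
k-th coefficient of p, with a nonzero factor, through products of the same length whose last
coefficient has larger index. The top coefficient of p is 1, so descent on the index and induction
on the length leave only the expectation of 1.

Vandermonde side (`cubeIntegral_sdCoeff`): with Δ the Vandermonde product, the equation is the
divergence theorem on the cube for Δ² f times the field xᵢ(1-xᵢ) p(z)/(z-xᵢ), which vanishes on the
faces in the normal direction.

Haar side (`integral_sdPoly_prod`): left invariance makes infinitesimal left translations integrate
to zero (`integral_leftDeriv`). With A, B the upper and lower left blocks of U, this is applied to
the entries of B adj(z - A†A) A†, times ∏ₗ det(yₗ - A†A), along the matrix unit mixing the two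
blocks. Summing over entries and using A†A + B†B = 1 gives the equation for f = ∏ₗ p(yₗ); such f
span the symmetric polynomials (`coeffAlgebra_le_span`).

On the determinantal side the kernel is the projection kernel onto polynomials of degree below N. At
ℓ = N the determinant is a multiple of Δ². The reproducing property integrates out one variable at a
time, which gives every marginal, and at ℓ = 0 the normalization constant. -/

noncomputable section

namespace BlockEncoding

/-! ### Uniqueness of solutions of the Schwinger–Dyson equations -/

section SchwingerDyson

set_option linter.unusedSectionVars false

variable {σ : Type*} [Fintype σ] [DecidableEq σ]

variable (σ) in
/-- The generic polynomial `∏ᵢ (X - xᵢ)` over the ring of polynomials in the `xᵢ`. -/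
def genPoly : (MvPolynomial σ ℝ)[X] := ∏ i, (X - C (MvPolynomial.X i))

/-- The generic polynomial with the `i`-th root removed. -/
def genPolyErase (i : σ) : (MvPolynomial σ ℝ)[X] :=
  ∏ j ∈ Finset.univ.erase i, (X - C (MvPolynomial.X j))

variable (σ) in
/-- The coefficients of `genPoly`, which are the elementary symmetric polynomials up to sign. -/
def genCoeff (k : ℕ) : MvPolynomial σ ℝ := (genPoly σ).coeff k

/-- The coefficients of `genPolyErase`. -/
def eraseCoeff (i : σ) (k : ℕ) : MvPolynomial σ ℝ := (genPolyErase i).coeff k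

lemma genPoly_eq_mul (i : σ) : genPoly σ = (X - C (MvPolynomial.X i)) * genPolyErase i := by
  exact (Finset.mul_prod_erase Finset.univ (fun j => X - C (MvPolynomial.X j)) (Finset.mem_univ i)).symm

lemma genPoly_monic : (genPoly σ).Monic := monic_prod_of_monic _ _ fun _ _ => monic_X_sub_C _

lemma natDegree_genPoly : (genPoly σ).natDegree = Fintype.card σ := by
  rw [genPoly, natDegree_prod_of_monic _ _ fun _ _ => monic_X_sub_C _]
  simp

lemma natDegree_genPolyErase (i : σ) : (genPolyErase i).natDegree = Fintype.card σ - 1 := by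
  rw [genPolyErase, natDegree_prod_of_monic _ _ fun _ _ => monic_X_sub_C _]
  simp

lemma genCoeff_card : genCoeff σ (Fintype.card σ) = 1 := by
  rw [genCoeff, ← natDegree_genPoly]
  exact genPoly_monic

lemma genCoeff_eq_zero {k : ℕ} (hk : Fintype.card σ < k) : genCoeff σ k = 0 :=
  coeff_eq_zero_of_natDegree_lt (by rwa [natDegree_genPoly])

lemma eraseCoeff_eq_zero (i : σ) {k : ℕ} (hk : Fintype.card σ ≤ k) : eraseCoeff i k = 0 := by
  have : 0 < Fintype.card σ := Fintype.card_pos_iff.2 ⟨i⟩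
  exact coeff_eq_zero_of_natDegree_lt (by rw [natDegree_genPolyErase]; omega)

lemma genCoeff_succ (i : σ) (k : ℕ) :
    genCoeff σ (k + 1) = eraseCoeff i k - MvPolynomial.X i * eraseCoeff i (k + 1) := by
  simp [genCoeff, genPoly_eq_mul i, sub_mul, eraseCoeff]

lemma genCoeff_zero (i : σ) : genCoeff σ 0 = - (MvPolynomial.X i * eraseCoeff i 0) := by
  simp [genCoeff, genPoly_eq_mul i, sub_mul, eraseCoeff]

lemma derivative_genPoly : derivative (genPoly σ) = ∑ i, genPolyErase i := by
  rw [genPoly, derivative_prod_finset]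
  simp [genPolyErase]

lemma sum_eraseCoeff (k : ℕ) :
    ∑ i : σ, eraseCoeff i k = ((k : MvPolynomial σ ℝ) + 1) * genCoeff σ (k + 1) := by
  have := congrArg (fun p => p.coeff k) (derivative_genPoly (σ := σ))
  simp only [coeff_derivative, finsetSum_coeff] at this
  rw [genCoeff, mul_comm, this]
  rfl

lemma sum_X_mul_eraseCoeff (k : ℕ) :
    ∑ i : σ, MvPolynomial.X i * eraseCoeff i k =
      ((k : MvPolynomial σ ℝ) - (Fintype.card σ : MvPolynomial σ ℝ)) * genCoeff σ k := by
  rcases k with _ | k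
  · rw [Finset.sum_congr rfl fun i _ => (neg_eq_iff_eq_neg.2 (genCoeff_zero i)).symm]
    simp
  · have h : ∀ i : σ, MvPolynomial.X i * eraseCoeff i (k + 1)
        = eraseCoeff i k - genCoeff σ (k + 1) := fun i => by rw [genCoeff_succ i]; ring
    rw [Finset.sum_congr rfl fun i _ => h i, Finset.sum_sub_distrib, sum_eraseCoeff]
    simp
    ring

/-- The generic polynomial is (X - xᵢ) times a polynomial free of xᵢ, hence affine in xᵢ. -/
lemma pderiv_genPoly_coeff (i : σ) (k : ℕ) :
    MvPolynomial.pderiv i (genCoeff σ k) = - eraseCoeff i k := by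
  have hE : ∀ k, MvPolynomial.pderiv i (eraseCoeff i k) = 0 := by
    have : ∀ s : Finset σ, i ∉ s → ∀ k, MvPolynomial.pderiv i
        ((∏ j ∈ s, (X - C (MvPolynomial.X j)) : (MvPolynomial σ ℝ)[X]).coeff k) = 0 := by
      intro s
      induction s using Finset.induction_on with
      | empty => intro _ k; simp [coeff_one]; split_ifs <;> simp
      | insert a s ha ih =>
        intro hi k
        simp only [Finset.mem_insert, not_or] at hi
        rw [Finset.prod_insert ha, sub_mul, coeff_sub, coeff_C_mul, map_sub, Derivation.leibniz,
          ih hi.2, MvPolynomial.pderiv_X_of_ne (Ne.symm hi.1)]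
        rcases k with _ | k
        · simp
        · simp [ih hi.2]
    exact fun k => this _ (Finset.notMem_erase _ _) k
  rcases k with _ | k
  · rw [genCoeff_zero i]; simp [Derivation.leibniz, hE]
  · rw [genCoeff_succ i]; simp [Derivation.leibniz, hE]

/-- The `k`-th coefficient of the Schwinger–Dyson polynomial of `f`. -/
def sdCoeff (f : MvPolynomial σ ℝ) (k : ℕ) : MvPolynomial σ ℝ :=
  f * (((k : MvPolynomial σ ℝ) + 1) ^ 2 * genCoeff σ (k + 1) +
    ((Fintype.card σ : MvPolynomial σ ℝ) * (Fintype.card σ + 1) - k * (k + 1)) * genCoeff σ k) +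
  ∑ i, MvPolynomial.pderiv i f * (MvPolynomial.X i * (1 - MvPolynomial.X i)) * eraseCoeff i k

variable (σ) in
/-- The span of the coefficients of `genPoly`. -/
def coeffSpan : Submodule ℝ (MvPolynomial σ ℝ) := Submodule.span ℝ (Set.range (genCoeff σ))

variable (σ) in
/-- The span of the coefficients of `genPoly` of index larger than `k`. -/
def coeffSpanIoi (k : ℕ) : Submodule ℝ (MvPolynomial σ ℝ) :=
  Submodule.span ℝ (genCoeff σ '' Set.Ioi k)

lemma genCoeff_mem (k : ℕ) : genCoeff σ k ∈ coeffSpan σ := Submodule.subset_span ⟨k, rfl⟩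

lemma genCoeff_mem_Ioi {k s : ℕ} (h : k < s) : genCoeff σ s ∈ coeffSpanIoi σ k :=
  Submodule.subset_span ⟨s, h, rfl⟩

lemma coeffSpanIoi_succ_le (k : ℕ) : coeffSpanIoi σ (k + 1) ≤ coeffSpanIoi σ k :=
  Submodule.span_mono (Set.image_mono fun _ h => (Nat.lt_succ_self k).trans h)

lemma natCast_mul_mem {W : Submodule ℝ (MvPolynomial σ ℝ)} (n : ℕ) {p : MvPolynomial σ ℝ}
    (h : p ∈ W) : (n : MvPolynomial σ ℝ) * p ∈ W := by
  rw [← nsmul_eq_mul]; exact W.nsmul_mem h n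

/-- Write eₖ for the coefficients of p and qᵢ,ₖ for those of p/(X - xᵢ). Substituting qᵢ,ₖ = eₖ₊₁ +
xᵢ qᵢ,ₖ₊₁ and then xᵢ qᵢ,ₖ' = qᵢ,ₖ'₋₁ - eₖ' moves the pair (k', k) to (k'-1, k+1). Each correction
is a product whose second factor has index above k. The recursion stops once k reaches the number of
variables, where qᵢ,ₖ vanishes. -/
lemma sum_eraseCoeff_mul_mem (k' k : ℕ) :
    ∑ i : σ, eraseCoeff i k' * eraseCoeff i k ∈ coeffSpan σ * coeffSpanIoi σ k := by
  obtain ⟨d, hd⟩ : ∃ d, Fintype.card σ ≤ k + d := ⟨Fintype.card σ, by omega⟩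
  induction d generalizing k k' with
  | zero =>
    rw [Finset.sum_eq_zero fun i _ => by rw [eraseCoeff_eq_zero i (k := k) (by omega), mul_zero]]
    exact zero_mem _
  | succ d ih =>
    have h1 : ∑ i : σ, eraseCoeff i k' * eraseCoeff i k =
        genCoeff σ (k + 1) * ∑ i, eraseCoeff i k' +
          ∑ i, (MvPolynomial.X i * eraseCoeff i k') * eraseCoeff i (k + 1) := by
      rw [Finset.mul_sum, ← Finset.sum_add_distrib]
      refine Finset.sum_congr rfl fun i _ => ?_
      rw [genCoeff_succ i]; ring
    have h2 : genCoeff σ (k + 1) * ∑ i, eraseCoeff i k' ∈ coeffSpan σ * coeffSpanIoi σ k := by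
      rw [sum_eraseCoeff, mul_comm (genCoeff σ (k + 1)), mul_assoc]
      have := Submodule.mul_mem_mul (genCoeff_mem (σ := σ) (k' + 1))
        (genCoeff_mem_Ioi (σ := σ) (Nat.lt_succ_self k))
      simpa using natCast_mul_mem (k' + 1) this
    have hle : coeffSpan σ * coeffSpanIoi σ (k + 1) ≤ coeffSpan σ * coeffSpanIoi σ k :=
      mul_le_mul_right (coeffSpanIoi_succ_le k) _
    have h4 : genCoeff σ k' * ∑ i : σ, eraseCoeff i (k + 1) ∈
        coeffSpan σ * coeffSpanIoi σ k := by
      rw [sum_eraseCoeff, mul_left_comm]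
      have := Submodule.mul_mem_mul (genCoeff_mem (σ := σ) k')
        (genCoeff_mem_Ioi (σ := σ) (show k < k + 1 + 1 by omega))
      simpa using natCast_mul_mem (k + 1 + 1) this
    rw [h1]
    refine add_mem h2 ?_
    rcases k' with _ | k'
    · rw [Finset.sum_congr rfl fun i _ => by
        rw [← neg_eq_iff_eq_neg.2 (genCoeff_zero i)], ← Finset.mul_sum, neg_mul]
      exact neg_mem h4
    · have h : ∀ i : σ, MvPolynomial.X i * eraseCoeff i (k' + 1) * eraseCoeff i (k + 1) =
          eraseCoeff i k' * eraseCoeff i (k + 1) - genCoeff σ (k' + 1) * eraseCoeff i (k + 1) := by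
        intro i; rw [genCoeff_succ i]; ring
      rw [Finset.sum_congr rfl fun i _ => h i, Finset.sum_sub_distrib, ← Finset.mul_sum]
      exact sub_mem (hle (ih k' (k + 1) (by omega))) h4

lemma sum_X_mul_eraseCoeff_mul_mem (k' k : ℕ) :
    ∑ i : σ, MvPolynomial.X i * eraseCoeff i k' * eraseCoeff i k ∈
      coeffSpan σ * coeffSpanIoi σ k := by
  have h4 : genCoeff σ k' * ∑ i : σ, eraseCoeff i k ∈ coeffSpan σ * coeffSpanIoi σ k := by
    rw [sum_eraseCoeff, mul_left_comm]
    have := Submodule.mul_mem_mul (genCoeff_mem (σ := σ) k')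
      (genCoeff_mem_Ioi (σ := σ) (show k < k + 1 by omega))
    simpa using natCast_mul_mem (k + 1) this
  rcases k' with _ | k'
  · rw [Finset.sum_congr rfl fun i _ => by
      rw [← neg_eq_iff_eq_neg.2 (genCoeff_zero i)], ← Finset.mul_sum, neg_mul]
    exact neg_mem h4
  · have h : ∀ i : σ, MvPolynomial.X i * eraseCoeff i (k' + 1) * eraseCoeff i k =
        eraseCoeff i k' * eraseCoeff i k - genCoeff σ (k' + 1) * eraseCoeff i k := by
      intro i; rw [genCoeff_succ i]; ring
    rw [Finset.sum_congr rfl fun i _ => h i, Finset.sum_sub_distrib, ← Finset.mul_sum]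
    exact sub_mem (sum_eraseCoeff_mul_mem k' k) h4

/-- The leading term comes from ∑ᵢ xᵢ qᵢ,ₖ = (k - n) eₖ, with n the number of variables. All other
terms produced by ∂ᵢ eₖ' = -qᵢ,ₖ' are quadratic sums already known to involve an index above k. -/
lemma sum_pderiv_genCoeff_mem (k' k : ℕ) :
    ∑ i : σ, MvPolynomial.pderiv i (genCoeff σ k') *
        (MvPolynomial.X i * (1 - MvPolynomial.X i)) * eraseCoeff i k -
      ((Fintype.card σ : MvPolynomial σ ℝ) - k) * (genCoeff σ k' * genCoeff σ k) ∈
      coeffSpan σ * coeffSpanIoi σ k := by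
  have h3 := sum_X_mul_eraseCoeff_mul_mem (σ := σ) k' k
  rcases k' with _ | k'
  · have h : ∀ i : σ, MvPolynomial.pderiv i (genCoeff σ 0) *
        (MvPolynomial.X i * (1 - MvPolynomial.X i)) * eraseCoeff i k =
        - (MvPolynomial.X i * eraseCoeff i 0 * eraseCoeff i k)
        - genCoeff σ 0 * (MvPolynomial.X i * eraseCoeff i k) := by
      intro i; rw [pderiv_genPoly_coeff, genCoeff_zero i]; ring
    rw [Finset.sum_congr rfl fun i _ => h i, Finset.sum_sub_distrib, Finset.sum_neg_distrib,
      ← Finset.mul_sum, sum_X_mul_eraseCoeff]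
    convert neg_mem h3 using 1
    ring
  · have h : ∀ i : σ, MvPolynomial.pderiv i (genCoeff σ (k' + 1)) *
        (MvPolynomial.X i * (1 - MvPolynomial.X i)) * eraseCoeff i k =
        (MvPolynomial.X i * eraseCoeff i k' * eraseCoeff i k)
        - (MvPolynomial.X i * eraseCoeff i (k' + 1) * eraseCoeff i k)
        - genCoeff σ (k' + 1) * (MvPolynomial.X i * eraseCoeff i k) := by
      intro i; rw [pderiv_genPoly_coeff, genCoeff_succ i]; ring
    rw [Finset.sum_congr rfl fun i _ => h i, Finset.sum_sub_distrib, Finset.sum_sub_distrib,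
      ← Finset.mul_sum, sum_X_mul_eraseCoeff]
    convert sub_mem (sum_X_mul_eraseCoeff_mul_mem (σ := σ) k' k) h3 using 1
    ring

/-- By the Leibniz rule each of the m factors of f contributes the leading term n - k once. The
remainder keeps length m + 1, so it is accessible to the descent on k. -/
lemma sum_pderiv_mem (k m : ℕ) {f : MvPolynomial σ ℝ} (hf : f ∈ coeffSpan σ ^ m) :
    ∑ i : σ, MvPolynomial.pderiv i f *
        (MvPolynomial.X i * (1 - MvPolynomial.X i)) * eraseCoeff i k -
      (m : MvPolynomial σ ℝ) * ((Fintype.card σ : MvPolynomial σ ℝ) - k) * (f * genCoeff σ k) ∈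
      coeffSpan σ ^ m * coeffSpanIoi σ k := by
  induction m generalizing f with
  | zero =>
    rw [pow_zero] at hf
    obtain ⟨r, rfl⟩ := Submodule.mem_one.1 hf
    simp [MvPolynomial.algebraMap_eq]
  | succ m ih =>
    rw [pow_succ] at hf
    induction hf using Submodule.mul_induction_on' with
    | mem_mul_mem p hp v hv =>
      induction hv using Submodule.span_induction with
      | mem v hv =>
        obtain ⟨k', rfl⟩ := hv
        have h1 := Submodule.mul_mem_mul hp (sum_pderiv_genCoeff_mem (σ := σ) k' k)
        have h2 := Submodule.mul_mem_mul (ih hp) (genCoeff_mem (σ := σ) k')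
        rw [← mul_assoc, ← pow_succ] at h1
        rw [mul_assoc, mul_comm (coeffSpanIoi σ k), ← mul_assoc, ← pow_succ] at h2
        convert add_mem h1 h2 using 1
        rw [mul_sub p, sub_mul _ _ (genCoeff σ k'), Finset.mul_sum, Finset.sum_mul, sub_add_sub_comm,
          ← Finset.sum_add_distrib]
        congr 1
        · refine Finset.sum_congr rfl fun i _ => ?_
          rw [Derivation.leibniz]; simp only [smul_eq_mul]; ring
        · push_cast; ring
      | zero => simp
      | add v w _ _ hv hw =>
        convert add_mem hv hw using 1
        rw [sub_add_sub_comm, ← Finset.sum_add_distrib]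
        congr 1
        · refine Finset.sum_congr rfl fun i _ => ?_
          rw [mul_add, map_add]; ring
        · ring
      | smul r v _ hv =>
        convert Submodule.smul_mem _ r hv using 1
        rw [smul_sub, Finset.smul_sum]
        congr 1
        · refine Finset.sum_congr rfl fun i _ => ?_
          rw [mul_smul_comm, Derivation.map_smul]; simp only [smul_mul_assoc]
        · simp only [mul_smul_comm, smul_mul_assoc]
    | add v _ w _ hv hw =>
        convert add_mem hv hw using 1
        rw [sub_add_sub_comm, ← Finset.sum_add_distrib]
        congr 1
        · refine Finset.sum_congr rfl fun i _ => ?_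
          rw [map_add]; ring
        · ring

variable (σ) in
/-- The algebra of symmetric polynomials, as generated by the coefficients of `genPoly`. -/
def coeffAlgebra : Subalgebra ℝ (MvPolynomial σ ℝ) := Algebra.adjoin ℝ (Set.range (genCoeff σ))

lemma coeffSpan_pow_le (m : ℕ) : coeffSpan σ ^ m ≤ (coeffAlgebra σ).toSubmodule := by
  induction m with
  | zero => rw [pow_zero]; exact Submodule.one_le.2 (one_mem (coeffAlgebra σ))
  | succ m ih =>
    rw [pow_succ]
    exact Submodule.mul_le.2 fun p hp v hv => (coeffAlgebra σ).mul_mem (ih hp)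
      ((Submodule.span_le (p := (coeffAlgebra σ).toSubmodule)).2 Algebra.subset_adjoin hv)

/-- A linear functional satisfying the Schwinger–Dyson equations that vanishes at `1` vanishes at
all symmetric polynomials. -/
theorem eq_zero_of_sdCoeff (δ : MvPolynomial σ ℝ →ₗ[ℝ] ℝ) (h1 : δ 1 = 0)
    (hδ : ∀ f ∈ coeffAlgebra σ, ∀ k, δ (sdCoeff f k) = 0) {f : MvPolynomial σ ℝ}
    (hf : f ∈ coeffAlgebra σ) : δ f = 0 := by
  have hV : ∀ m, ∀ f ∈ coeffSpan σ ^ m, δ f = 0 := by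
    intro m
    induction m with
    | zero =>
      intro f hf
      rw [pow_zero] at hf
      obtain ⟨r, rfl⟩ := Submodule.mem_one.1 hf
      rw [Algebra.algebraMap_eq_smul_one, map_smul, h1, smul_zero]
    | succ m ih =>
      -- Descent on k at fixed length m, with d bounding the distance from k to the number of
      -- variables. At that top index the coefficient is 1 and the length drops to m; above it the
      -- coefficient is 0.
      have key : ∀ d k, Fintype.card σ ≤ k + d → ∀ f ∈ coeffSpan σ ^ m,
          δ (f * genCoeff σ k) = 0 := by
        intro d
        induction d using Nat.strong_induction_on with
        | _ d ihd =>
        intro k hk f hf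
        rcases lt_trichotomy k (Fintype.card σ) with h | h | h
        · have hW : ∀ w ∈ coeffSpan σ ^ m * coeffSpanIoi σ k, δ w = 0 := by
            intro w hw
            induction hw using Submodule.mul_induction_on' with
            | mem_mul_mem p hp v hv =>
              induction hv using Submodule.span_induction with
              | mem v hv =>
                obtain ⟨s, hs, rfl⟩ := hv
                have hs : k < s := hs
                exact ihd (d - 1) (by omega) s (by omega) p hp
              | zero => simp
              | add v w _ _ hv hw => rw [mul_add, map_add, hv, hw, add_zero]
              | smul r v _ hv => rw [mul_smul_comm, map_smul, hv, smul_zero]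
            | add v _ w _ hv hw => rw [map_add, hv, hw, add_zero]
          have hs := hδ f (coeffSpan_pow_le m hf) k
          have hm := hW _ (sum_pderiv_mem k m hf)
          have hsucc := hW _ (Submodule.mul_mem_mul hf (genCoeff_mem_Ioi (Nat.lt_succ_self k)))
          have e : sdCoeff f k - (∑ i : σ, MvPolynomial.pderiv i f *
              (MvPolynomial.X i * (1 - MvPolynomial.X i)) * eraseCoeff i k -
              (m : MvPolynomial σ ℝ) * ((Fintype.card σ : MvPolynomial σ ℝ) - k) *
                (f * genCoeff σ k)) =
              ((k : ℝ) + 1) ^ 2 • (f * genCoeff σ (k + 1)) +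
              ((Fintype.card σ : ℝ) * (Fintype.card σ + 1) - k * (k + 1) +
                m * (Fintype.card σ - k)) • (f * genCoeff σ k) := by
            rw [sdCoeff, MvPolynomial.smul_eq_C_mul, MvPolynomial.smul_eq_C_mul]
            simp only [map_add, map_sub, map_mul, map_pow, map_natCast, map_one]
            ring
          have e2 := congrArg δ e
          rw [map_sub, hs, hm, map_add, map_smul, map_smul, hsucc, smul_zero, zero_add, sub_zero,
            smul_eq_mul] at e2
          -- The factor equals (n - k)(n + k + 1 + m), which is positive for k < n.
          refine (mul_eq_zero.1 e2.symm).resolve_left (ne_of_gt ?_)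
          have hk' : (k : ℝ) < Fintype.card σ := by exact_mod_cast h
          have : (0 : ℝ) ≤ m := by positivity
          have : (0 : ℝ) ≤ k := by positivity
          nlinarith
        · rw [h, genCoeff_card, mul_one]; exact ih f hf
        · rw [genCoeff_eq_zero h, mul_zero, map_zero]
      intro f hf
      rw [pow_succ] at hf
      induction hf using Submodule.mul_induction_on' with
      | mem_mul_mem p hp v hv =>
        induction hv using Submodule.span_induction with
        | mem v hv =>
          obtain ⟨s, rfl⟩ := hv
          exact key (Fintype.card σ) s (by omega) p hp
        | zero => simp
        | add v w _ _ hv hw => rw [mul_add, map_add, hv, hw, add_zero]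
        | smul r v _ hv => rw [mul_smul_comm, map_smul, hv, smul_zero]
      | add v _ w _ hv hw => rw [map_add, hv, hw, add_zero]
  rw [coeffAlgebra, ← Subalgebra.mem_toSubmodule, Algebra.adjoin_eq_span] at hf
  induction hf using Submodule.span_induction with
  | mem v hv =>
    obtain ⟨m, hm⟩ : ∃ m, v ∈ coeffSpan σ ^ m := by
      induction hv using Submonoid.closure_induction with
      | mem x hx => exact ⟨1, by rw [pow_one]; exact Submodule.subset_span hx⟩
      | one => exact ⟨0, by rw [pow_zero]; exact Submodule.one_le.1 le_rfl⟩
      | mul x y _ _ hx hy =>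
        obtain ⟨m, hm⟩ := hx
        obtain ⟨n, hn⟩ := hy
        exact ⟨m + n, by rw [pow_add]; exact Submodule.mul_mem_mul hm hn⟩
    exact hV m v hm
  | zero => simp
  | add v w _ _ hv hw => rw [map_add, hv, hw, add_zero]
  | smul r v _ hv => rw [map_smul, hv, smul_zero]

end SchwingerDyson

/-! ### The polynomial vector field behind the equations -/

section SchwingerDyson

variable {σ : Type*} [Fintype σ] [DecidableEq σ]

/-- The Schwinger–Dyson polynomial of `f`. -/
def sdPoly (f : MvPolynomial σ ℝ) : (MvPolynomial σ ℝ)[X] :=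
  C f * (X * (1 - X) * derivative (derivative (genPoly σ)) + (1 - 2 * X) * derivative (genPoly σ) +
    C ((Fintype.card σ : MvPolynomial σ ℝ) * (Fintype.card σ + 1)) * genPoly σ) +
  ∑ i, C (MvPolynomial.pderiv i f * (MvPolynomial.X i * (1 - MvPolynomial.X i))) * genPolyErase i

lemma coeff_sdPoly (f : MvPolynomial σ ℝ) (k : ℕ) : (sdPoly f).coeff k = sdCoeff f k := by
  have e : X * (1 - X) * derivative (derivative (genPoly σ)) + (1 - 2 * X) * derivative (genPoly σ)
      = (derivative (derivative (genPoly σ)) * X - derivative (derivative (genPoly σ)) * X ^ 2) +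
        (derivative (genPoly σ) - C 2 * (derivative (genPoly σ) * X)) := by
    simp only [map_ofNat]; ring
  rw [sdPoly, sdCoeff, coeff_add, finsetSum_coeff, coeff_C_mul, e]
  congr 1
  · congr 1
    rw [coeff_add, coeff_add, coeff_C_mul, coeff_sub, coeff_sub, coeff_C_mul]
    rcases k with _ | _ | k
    · simp [coeff_derivative, genCoeff]
    · simp [coeff_mul_X_pow', coeff_derivative, genCoeff]; ring
    · simp [coeff_mul_X_pow', coeff_derivative, genCoeff]; ring
  · exact Finset.sum_congr rfl fun i _ => by rw [coeff_C_mul]; rfl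

/-- If a functional vanishes at all values of a polynomial on an infinite set of scalars, then it
vanishes at all its coefficients. -/
lemma apply_coeff_eq_zero {A : Type*} [CommRing A] [Algebra ℝ A] (δ : A →ₗ[ℝ] ℝ) (p : A[X])
    {s : Set ℝ} (hs : s.Infinite) (h : ∀ z ∈ s, δ (p.eval (algebraMap ℝ A z)) = 0) (k : ℕ) :
    δ (p.coeff k) = 0 := by
  -- Q is δ applied coefficientwise, so its value at a scalar z is δ of p(z); infinitely many roots
  -- force Q = 0.
  let Q : ℝ[X] := ∑ j ∈ Finset.range (p.natDegree + 1), monomial j (δ (p.coeff j))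
  have hQ : Q = 0 := by
    refine eq_zero_of_infinite_isRoot Q (hs.mono fun z hz => ?_)
    have := h z hz
    rw [eval_eq_sum_range, map_sum] at this
    simp only [Set.mem_ofPred_eq, IsRoot, Q, eval_finsetSum, eval_monomial]
    rw [← this]
    refine Finset.sum_congr rfl fun j _ => ?_
    rw [← map_pow, mul_comm, mul_comm (p.coeff j), ← Algebra.smul_def, map_smul, smul_eq_mul]
  by_cases hk : k ≤ p.natDegree
  · have := congrArg (fun q => q.coeff k) hQ
    simpa [Q, finsetSum_coeff, coeff_monomial, Nat.lt_succ_iff, hk] using this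
  · rw [coeff_eq_zero_of_natDegree_lt (by omega), map_zero]

lemma derivative_genPolyErase (a : σ) : derivative (genPolyErase a) =
    ∑ b ∈ Finset.univ.erase a, ∏ j ∈ (Finset.univ.erase a).erase b,
      (X - C (MvPolynomial.X j : MvPolynomial σ ℝ)) := by
  rw [genPolyErase, derivative_prod_finset]
  simp

lemma genPolyErase_eq_mul {a b : σ} (h : b ≠ a) : genPolyErase a =
    (X - C (MvPolynomial.X b : MvPolynomial σ ℝ)) * ∏ j ∈ (Finset.univ.erase a).erase b,
      (X - C (MvPolynomial.X j : MvPolynomial σ ℝ)) :=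
  (Finset.mul_prod_erase (Finset.univ.erase a) (fun j => X - C (MvPolynomial.X j))
    (Finset.mem_erase.2 ⟨h, Finset.mem_univ _⟩)).symm

lemma pderiv_eval_genPolyErase (z : ℝ) (i : σ) :
    MvPolynomial.pderiv i ((genPolyErase i).eval (MvPolynomial.C z)) = 0 := by
  rw [genPolyErase, eval_prod]
  refine Finset.prod_induction _ (fun p => MvPolynomial.pderiv i p = 0) ?_ (by simp) ?_
  · intro p q hp hq
    rw [Derivation.leibniz, hp, hq, smul_zero, smul_zero, add_zero]
  · intro j hj
    simp [MvPolynomial.pderiv_X_of_ne (Finset.ne_of_mem_erase hj)]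

/-- The polynomial vector field `∑ᵢ xᵢ (1 - xᵢ) ∏_{j ≠ i} (z - xⱼ) ∂ᵢ`. -/
def sdField (z : ℝ) : Derivation ℝ (MvPolynomial σ ℝ) (MvPolynomial σ ℝ) :=
  ∑ i, (MvPolynomial.X i * (1 - MvPolynomial.X i) * (genPolyErase i).eval (MvPolynomial.C z)) •
    MvPolynomial.pderiv i

lemma sdField_apply (z : ℝ) (f : MvPolynomial σ ℝ) : sdField z f =
    ∑ i, MvPolynomial.X i * (1 - MvPolynomial.X i) * (genPolyErase i).eval (MvPolynomial.C z) *
      MvPolynomial.pderiv i f := by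
  rw [sdField, ← Derivation.coeFnAddMonoidHom_apply, map_sum, Finset.sum_apply]
  rfl

lemma sdField_X (z : ℝ) (a : σ) : sdField z (MvPolynomial.X a : MvPolynomial σ ℝ) =
    MvPolynomial.X a * (1 - MvPolynomial.X a) * (genPolyErase a).eval (MvPolynomial.C z) := by
  rw [sdField_apply, Finset.sum_eq_single a]
  · simp
  · intro b _ hb
    rw [MvPolynomial.pderiv_X_of_ne hb.symm, mul_zero]
  · simp

/-- The logarithmic derivative of `x_a - x_b` along `sdField z`. -/
def sdPair (z : ℝ) (a b : σ) : MvPolynomial σ ℝ :=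
  MvPolynomial.C (z * (1 - z)) * (∏ j ∈ (Finset.univ.erase a).erase b,
      (X - C (MvPolynomial.X j : MvPolynomial σ ℝ))).eval (MvPolynomial.C z) +
    (genPoly σ).eval (MvPolynomial.C z)

lemma sdPair_comm (z : ℝ) (a b : σ) : sdPair z a b = sdPair z b a := by
  rw [sdPair, sdPair, Finset.erase_right_comm]

/-- After removing the common product over j ≠ a, b this is x_a(1-x_a)(z-x_b) - x_b(1-x_b)(z-x_a) =
(x_a-x_b)(z(1-z) + (z-x_a)(z-x_b)). Divisibility by x_a - x_b makes the Vandermonde product an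
eigenvector of the field over the polynomial ring. -/
lemma sdField_X_sub_X (z : ℝ) {a b : σ} (h : b ≠ a) :
    sdField z (MvPolynomial.X a - MvPolynomial.X b : MvPolynomial σ ℝ) =
      sdPair z a b * (MvPolynomial.X a - MvPolynomial.X b) := by
  rw [map_sub, sdField_X, sdField_X, sdPair, genPoly_eq_mul a, genPolyErase_eq_mul h,
    genPolyErase_eq_mul h.symm, Finset.erase_right_comm]
  simp only [eval_mul, eval_sub, eval_X, eval_C, map_mul, map_sub, map_one]
  ring

lemma sdField_prod {ι : Type*} (z : ℝ) (s : Finset ι) (g c : ι → MvPolynomial σ ℝ)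
    (h : ∀ i ∈ s, sdField z (g i) = c i * g i) :
    sdField z (∏ i ∈ s, g i) = (∑ i ∈ s, c i) * ∏ i ∈ s, g i := by
  classical
  induction s using Finset.induction_on with
  | empty => simp
  | insert a s ha ih =>
    rw [Finset.prod_insert ha, Finset.sum_insert ha, Derivation.leibniz,
      ih fun i hi => h i (Finset.mem_insert_of_mem hi), h a (Finset.mem_insert_self _ _)]
    simp only [smul_eq_mul]
    ring

/-- The products with two roots removed, summed over ordered pairs, form p''. The remaining term is
counted once per ordered pair. -/
lemma sum_sdPair (z : ℝ) : ∑ a : σ, ∑ b ∈ Finset.univ.erase a, sdPair z a b =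
    MvPolynomial.C (z * (1 - z)) * (derivative (derivative (genPoly σ))).eval (MvPolynomial.C z) +
    (Fintype.card σ : MvPolynomial σ ℝ) * ((Fintype.card σ : MvPolynomial σ ℝ) - 1) *
      (genPoly σ).eval (MvPolynomial.C z) := by
  have : ∀ a : σ, ∑ b ∈ Finset.univ.erase a, sdPair z a b =
      MvPolynomial.C (z * (1 - z)) * (derivative (genPolyErase a)).eval (MvPolynomial.C z) +
      ((Fintype.card σ : MvPolynomial σ ℝ) - 1) * (genPoly σ).eval (MvPolynomial.C z) := by
    intro a
    have : 0 < Fintype.card σ := Fintype.card_pos_iff.2 ⟨a⟩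
    simp only [sdPair, Finset.sum_add_distrib, derivative_genPolyErase, eval_finsetSum,
      Finset.mul_sum, Finset.sum_const, Finset.card_erase_of_mem (Finset.mem_univ a),
      Finset.card_univ, nsmul_eq_mul, Nat.cast_pred this]
  rw [Finset.sum_congr rfl fun a _ => this a, Finset.sum_add_distrib, derivative_genPoly,
    derivative_sum, eval_finsetSum, Finset.mul_sum]
  simp
  ring

end SchwingerDyson

/-! ### Schwinger–Dyson equations for the squared Vandermonde density on the cube -/

variable {N : ℕ}

variable (N) in
/-- The Vandermonde polynomial. -/
def vdm : MvPolynomial (Fin N) ℝ :=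
  ∏ i, ∏ j ∈ Finset.Ioi i, (MvPolynomial.X j - MvPolynomial.X i)

/-- Logarithmic derivatives add over factors. Squaring doubles each unordered pair, which matches
the sum over ordered pairs because the pair term is symmetric. -/
lemma sdField_vdm_sq (z : ℝ) : sdField z (vdm N ^ 2) =
    (∑ a : Fin N, ∑ b ∈ Finset.univ.erase a, sdPair z a b) * vdm N ^ 2 := by
  have h1 : sdField z (vdm N) = (∑ i : Fin N, ∑ j ∈ Finset.Ioi i, sdPair z j i) * vdm N := by
    refine sdField_prod z _ _ _ fun i _ => sdField_prod z _ _ _ fun j hj => ?_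
    exact sdField_X_sub_X z (Finset.mem_Ioi.1 hj).ne
  have h2 : ∑ a : Fin N, ∑ b ∈ Finset.univ.erase a, sdPair z a b =
      2 * ∑ i : Fin N, ∑ j ∈ Finset.Ioi i, sdPair z j i := by
    have hs : ∀ a : Fin N, Finset.univ.erase a = Finset.Ioi a ∪ Finset.Iio a := by
      intro a; ext b; simp [lt_or_lt_iff_ne, eq_comm]
    have hd : ∀ a : Fin N, Disjoint (Finset.Ioi a) (Finset.Iio a) := fun a =>
      Finset.disjoint_left.2 fun b h1 h2 => by simp at h1 h2; omega
    simp_rw [hs, Finset.sum_union (hd _), Finset.sum_add_distrib]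
    rw [two_mul]
    congr 1
    · simp_rw [sdPair_comm z]
    · rw [Finset.sum_comm' (t' := Finset.univ) (s' := fun i => Finset.Ioi i)]
      simp
  rw [sq, Derivation.leibniz, h1, h2]
  simp only [smul_eq_mul]
  ring

/-- The constant N(N+1) splits as N(N-1) from the derivative of the squared Vandermonde and 2N from
the divergence of the field itself, in which 1 - 2xᵢ = (1 - 2z) + 2(z - xᵢ). -/
lemma sum_pderiv_vdm (z : ℝ) (f : MvPolynomial (Fin N) ℝ) :
    ∑ i, MvPolynomial.pderiv i (MvPolynomial.X i * (1 - MvPolynomial.X i) *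
        ((genPolyErase i).eval (MvPolynomial.C z) * (f * vdm N ^ 2))) =
      (sdPoly f).eval (MvPolynomial.C z) * vdm N ^ 2 := by
  have h1 : ∀ i : Fin N, MvPolynomial.pderiv i (MvPolynomial.X i * (1 - MvPolynomial.X i) *
        ((genPolyErase i).eval (MvPolynomial.C z) * (f * vdm N ^ 2))) =
      (1 - 2 * MvPolynomial.X i) * (genPolyErase i).eval (MvPolynomial.C z) * (f * vdm N ^ 2) +
      MvPolynomial.X i * (1 - MvPolynomial.X i) * (genPolyErase i).eval (MvPolynomial.C z) *
        MvPolynomial.pderiv i f * vdm N ^ 2 +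
      f * (MvPolynomial.X i * (1 - MvPolynomial.X i) *
        (genPolyErase i).eval (MvPolynomial.C z) * MvPolynomial.pderiv i (vdm N ^ 2)) := by
    intro i
    simp only [Derivation.leibniz, pderiv_eval_genPolyErase, smul_eq_mul, map_sub,
      MvPolynomial.pderiv_X_self, Derivation.map_one_eq_zero]
    ring
  have h2 : ∑ i : Fin N, (1 - 2 * MvPolynomial.X i) *
      (genPolyErase i).eval (MvPolynomial.C z) =
      (1 - 2 * MvPolynomial.C z) * (derivative (genPoly (Fin N))).eval (MvPolynomial.C z) +
        2 * (N : MvPolynomial (Fin N) ℝ) * (genPoly (Fin N)).eval (MvPolynomial.C z) := by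
    have : ∀ i : Fin N, (1 - 2 * MvPolynomial.X i) * (genPolyErase i).eval (MvPolynomial.C z) =
        (1 - 2 * MvPolynomial.C z) * (genPolyErase i).eval (MvPolynomial.C z) +
        2 * (genPoly (Fin N)).eval (MvPolynomial.C z) := by
      intro i
      rw [genPoly_eq_mul i]; simp only [eval_mul, eval_sub, eval_X, eval_C]; ring
    rw [Finset.sum_congr rfl fun i _ => this i, Finset.sum_add_distrib, ← Finset.mul_sum,
      derivative_genPoly, eval_finsetSum]
    simp; ring
  rw [Finset.sum_congr rfl fun i _ => h1 i, Finset.sum_add_distrib, Finset.sum_add_distrib,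
    ← Finset.sum_mul, ← Finset.sum_mul, ← Finset.mul_sum, h2, ← sdField_apply, ← sdField_apply,
    sdField_vdm_sq, sum_sdPair, sdPoly]
  simp only [eval_add, eval_mul, eval_sub, eval_one, eval_X, eval_C, eval_finsetSum, eval_ofNat,
    Fintype.card_fin, sdField_apply, map_mul, map_sub, map_one]
  have e : ∀ i : Fin N, MvPolynomial.X i * (1 - MvPolynomial.X i) *
      (genPolyErase i).eval (MvPolynomial.C z) * MvPolynomial.pderiv i f =
      MvPolynomial.pderiv i f * (MvPolynomial.X i * (1 - MvPolynomial.X i)) *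
        (genPolyErase i).eval (MvPolynomial.C z) := fun i => by ring
  rw [Finset.sum_congr rfl fun i _ => e i]
  ring

variable (N) in
/-- Integration of polynomials over the unit cube. -/
def cubeIntegral : MvPolynomial (Fin N) ℝ →ₗ[ℝ] ℝ where
  toFun f := ∫ x in Set.Icc (0 : Fin N → ℝ) 1, MvPolynomial.eval x f
  map_add' f g := by
    simp only [map_add]
    exact integral_add (MvPolynomial.continuous_eval f).integrableOn_Icc
      (MvPolynomial.continuous_eval g).integrableOn_Icc
  map_smul' c f := by
    simp only [MvPolynomial.smul_eval, RingHom.id_apply, smul_eq_mul]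
    exact integral_const_mul _ _

lemma cubeIntegral_monomial (s : Fin N →₀ ℕ) (c : ℝ) :
    cubeIntegral N (MvPolynomial.monomial s c) = c * ∏ i, ((s i : ℝ) + 1)⁻¹ := by
  have h : (volume : Measure (Fin N → ℝ)).restrict (Set.Icc 0 1) =
      Measure.pi fun _ => (volume : Measure ℝ).restrict (Set.Icc 0 1) := by
    rw [← Measure.restrict_pi_pi, ← Set.pi_univ_Icc]; rfl
  have : cubeIntegral N (MvPolynomial.monomial s c) =
      ∫ x in Set.Icc (0 : Fin N → ℝ) 1, MvPolynomial.eval x (MvPolynomial.monomial s c) := rfl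
  rw [this, h]
  simp only [MvPolynomial.eval_monomial, Finsupp.prod_fintype, pow_zero, implies_true]
  rw [integral_const_mul, integral_fintype_prod_eq_prod (fun i (x : ℝ) => x ^ s i)]
  congr 1
  refine Finset.prod_congr rfl fun i _ => ?_
  rw [integral_Icc_eq_integral_Ioc, ← intervalIntegral.integral_of_le zero_le_one, integral_pow]
  simp

/-- The factor xᵢ(1 - xᵢ) kills the boundary terms on the two faces normal to direction i. On a
monomial, the exponents produced by differentiation cancel the denominators of the two moments. -/
lemma cubeIntegral_pderiv (i : Fin N) (f : MvPolynomial (Fin N) ℝ) :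
    cubeIntegral N (MvPolynomial.pderiv i
      (MvPolynomial.X i * (1 - MvPolynomial.X i) * f)) = 0 := by
  induction f using MvPolynomial.induction_on' with
  | add p q hp hq => rw [mul_add, map_add, map_add, hp, hq, add_zero]
  | monomial s c =>
    have e : MvPolynomial.X i * (1 - MvPolynomial.X i) * MvPolynomial.monomial s c =
        MvPolynomial.monomial (s + Finsupp.single i 1) c -
        MvPolynomial.monomial (s + Finsupp.single i 1 + Finsupp.single i 1) c := by
      rw [MvPolynomial.monomial_add_single, MvPolynomial.monomial_add_single,
        MvPolynomial.monomial_add_single]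
      ring
    rw [e, map_sub, MvPolynomial.pderiv_monomial, MvPolynomial.pderiv_monomial, map_sub,
      cubeIntegral_monomial, cubeIntegral_monomial, add_tsub_cancel_right, add_tsub_cancel_right]
    rw [← Finset.mul_prod_erase _ _ (Finset.mem_univ i), ← Finset.mul_prod_erase _ _ (Finset.mem_univ i)]
    have e2 : ∏ x ∈ Finset.univ.erase i, ((((s + Finsupp.single i 1 : Fin N →₀ ℕ) x : ℕ) : ℝ) + 1)⁻¹ =
        ∏ x ∈ Finset.univ.erase i, ((s x : ℝ) + 1)⁻¹ :=
      Finset.prod_congr rfl fun j hj => by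
        simp [(Finset.ne_of_mem_erase hj).symm]
    rw [e2]
    have h1 : (s i : ℝ) + 1 ≠ 0 := by positivity
    have h2 : (s i : ℝ) + 1 + 1 ≠ 0 := by positivity
    simp
    field_simp
    simp

/-- The Schwinger–Dyson equations for the Legendre ensemble. -/
theorem cubeIntegral_sdCoeff (f : MvPolynomial (Fin N) ℝ) (k : ℕ) :
    cubeIntegral N (sdCoeff f k * vdm N ^ 2) = 0 := by
  rw [← coeff_sdPoly]
  refine apply_coeff_eq_zero (cubeIntegral N ∘ₗ LinearMap.mulRight ℝ (vdm N ^ 2)) (sdPoly f)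
    Set.infinite_univ (fun z _ => ?_) k
  change cubeIntegral N ((sdPoly f).eval (MvPolynomial.C z) * vdm N ^ 2) = 0
  rw [← sum_pderiv_vdm, map_sum]
  exact Finset.sum_eq_zero fun i _ => cubeIntegral_pderiv i _

/-! ### The Ward identity on the unitary group -/

section Ward

variable {n : Type*} [Fintype n] [DecidableEq n]

section

attribute [local instance] Matrix.linftyOpNormedRing Matrix.linftyOpNormedAlgebra

/-- The exponential needs a normed algebra, hence the operator norm here. Stating the derivative
entrywise lets it be used below, where matrices carry the entrywise sup norm. -/
lemma hasDerivAt_matrixExp_apply (Y : Matrix n n ℂ) (i j : n) (t : ℝ) :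
    HasDerivAt (fun s : ℝ => NormedSpace.exp (s • Y) i j)
      ((Y * NormedSpace.exp (t • Y)) i j) t := by
  have h := hasDerivAt_exp_smul_const' Y t
  exact ((Matrix.entryLinearMap ℝ ℂ i j).toContinuousLinearMap.hasFDerivAt.comp_hasDerivAt t h)

end

lemma exp_mem_unitaryGroup {Y : Matrix n n ℂ} (hY : Y.conjTranspose = -Y) (t : ℝ) :
    NormedSpace.exp (t • Y) ∈ Matrix.unitaryGroup n ℂ := by
  rw [Matrix.mem_unitaryGroup_iff, Matrix.star_eq_conjTranspose, ← Matrix.exp_conjTranspose,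
    Matrix.conjTranspose_smul, hY, star_trivial, smul_neg,
    ← Matrix.exp_add_of_commute _ _ (Commute.neg_right (Commute.refl (t • Y))), add_neg_cancel,
    NormedSpace.exp_zero]

attribute [local instance] Matrix.normedAddCommGroup Matrix.normedSpace

instance instCompactSpaceUnitaryGroup : CompactSpace (Matrix.unitaryGroup n ℂ) := by
  refine isCompact_iff_compactSpace.1 ?_
  have : ProperSpace (Matrix n n ℂ) := FiniteDimensional.proper ℂ _
  refine Metric.isCompact_of_isClosed_isBounded ?_ ?_
  · have : ((Matrix.unitaryGroup n ℂ : Set (Matrix n n ℂ))) = {A | A * star A = 1} := by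
      ext A; exact Matrix.mem_unitaryGroup_iff
    rw [this]
    exact isClosed_eq (continuous_id.matrix_mul continuous_id.matrix_conjTranspose)
      continuous_const
  · refine (Metric.isBounded_iff_subset_closedBall 0).2 ⟨1, fun A hA => ?_⟩
    rw [mem_closedBall_zero_iff]
    exact (Matrix.norm_le_iff zero_le_one).2 fun i j => entry_norm_bound_of_unitary hA i j

lemma continuous_unitary_pair : Continuous fun U : Matrix.unitaryGroup n ℂ =>
    ((U : Matrix n n ℂ), (U : Matrix n n ℂ).conjTranspose) :=
  continuous_subtype_val.prodMk continuous_subtype_val.matrix_conjTranspose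

lemma integrable_of_continuous_unitary {E : Type*} [NormedAddCommGroup E]
    [SecondCountableTopology E]
    {μ : Measure (Matrix.unitaryGroup n ℂ)} [IsFiniteMeasure μ]
    {f : Matrix.unitaryGroup n ℂ → E} (hf : Continuous f) : Integrable f μ := by
  obtain ⟨C, hC⟩ := isCompact_univ.exists_bound_of_continuousOn hf.continuousOn
  exact Integrable.of_bound hf.aestronglyMeasurable C
    (Filter.Eventually.of_forall fun U => hC U (Set.mem_univ _))

/-- The derivative of `G` at `(U, U†)` in the direction of the infinitesimal left translation by
`Y`. -/
def leftDeriv (G : Matrix n n ℂ × Matrix n n ℂ → ℂ) (Y : Matrix n n ℂ)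
    (U : Matrix.unitaryGroup n ℂ) : ℂ :=
  fderiv ℂ G ((U : Matrix n n ℂ), (U : Matrix n n ℂ).conjTranspose)
    (Y * U, -((U : Matrix n n ℂ).conjTranspose * Y))

lemma continuous_leftDeriv {G : Matrix n n ℂ × Matrix n n ℂ → ℂ} (hG : ContDiff ℂ 1 G)
    (Y : Matrix n n ℂ) : Continuous (leftDeriv G Y) := by
  have h1 := (hG.continuous_fderiv one_ne_zero).comp (continuous_unitary_pair (n := n))
  have h2 : Continuous fun U : Matrix.unitaryGroup n ℂ =>
      ((Y * U, -((U : Matrix n n ℂ).conjTranspose * Y)) : Matrix n n ℂ × Matrix n n ℂ) :=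
    (continuous_const.matrix_mul continuous_subtype_val).prodMk
      (continuous_subtype_val.matrix_conjTranspose.matrix_mul continuous_const).neg
  exact h1.clm_apply h2

lemma integral_leftDeriv_of_skew (μ : Measure (Matrix.unitaryGroup n ℂ)) [IsFiniteMeasure μ]
    [μ.IsMulLeftInvariant] {G : Matrix n n ℂ × Matrix n n ℂ → ℂ} (hG : ContDiff ℂ 1 G)
    {Y : Matrix n n ℂ} (hY : Y.conjTranspose = -Y) : ∫ U, leftDeriv G Y U ∂μ = 0 := by
  let g : ℝ → Matrix.unitaryGroup n ℂ := fun t => ⟨NormedSpace.exp (t • Y), exp_mem_unitaryGroup hY t⟩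
  let f : Matrix.unitaryGroup n ℂ → ℂ := fun U =>
    G ((U : Matrix n n ℂ), (U : Matrix n n ℂ).conjTranspose)
  have hf : Continuous f := hG.continuous.comp continuous_unitary_pair
  have hder : ∀ U : Matrix.unitaryGroup n ℂ, ∀ t : ℝ,
      HasDerivAt (fun s => f (g s * U)) (leftDeriv G Y (g t * U)) t := by
    intro U t
    have hc1 : HasDerivAt (fun s : ℝ => ((g s * U : Matrix.unitaryGroup n ℂ) : Matrix n n ℂ))
        (Y * ((g t * U : Matrix.unitaryGroup n ℂ) : Matrix n n ℂ)) t := by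
      refine hasDerivAt_pi.2 fun i => hasDerivAt_pi.2 fun j => ?_
      have := HasDerivAt.fun_sum (u := Finset.univ) fun k _ =>
        (hasDerivAt_matrixExp_apply Y i k t).mul_const ((U : Matrix n n ℂ) k j)
      have e : (Y * ((g t * U : Matrix.unitaryGroup n ℂ) : Matrix n n ℂ)) i j =
          ∑ k, (Y * NormedSpace.exp (t • Y)) i k * (U : Matrix n n ℂ) k j := by
        rw [Submonoid.coe_mul, ← Matrix.mul_assoc, Matrix.mul_apply]
      rw [← e] at this
      exact this
    have hc2 : HasDerivAt
        (fun s : ℝ => ((g s * U : Matrix.unitaryGroup n ℂ) : Matrix n n ℂ).conjTranspose)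
        (-(((g t * U : Matrix.unitaryGroup n ℂ) : Matrix n n ℂ).conjTranspose * Y)) t := by
      have e : -(((g t * U : Matrix.unitaryGroup n ℂ) : Matrix n n ℂ).conjTranspose * Y) =
          (Y * ((g t * U : Matrix.unitaryGroup n ℂ) : Matrix n n ℂ)).conjTranspose := by
        rw [Matrix.conjTranspose_mul, hY, Matrix.mul_neg]
      rw [e]
      refine hasDerivAt_pi.2 fun i => hasDerivAt_pi.2 fun j => ?_
      exact (hasDerivAt_pi.1 (hasDerivAt_pi.1 hc1 j) i).star
    exact ((hG.differentiable one_ne_zero _).hasFDerivAt.restrictScalars ℝ).comp_hasDerivAt t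
      (hc1.prodMk hc2)
  obtain ⟨C, hC⟩ := isCompact_univ.exists_bound_of_continuousOn
    (continuous_leftDeriv hG Y).continuousOn
  have hmul : ∀ t, Continuous fun U => g t * U := fun t => continuous_const.mul continuous_id
  have key := (hasDerivAt_integral_of_dominated_loc_of_deriv_le (μ := μ) (bound := fun _ => C)
    (F := fun t U => f (g t * U)) (F' := fun t U => leftDeriv G Y (g t * U)) (x₀ := (0 : ℝ))
    Filter.univ_mem (Filter.Eventually.of_forall fun t =>
      (hf.comp (hmul t)).aestronglyMeasurable)
    (integrable_of_continuous_unitary (hf.comp (hmul 0)))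
    ((continuous_leftDeriv hG Y).comp (hmul 0)).aestronglyMeasurable
    (Filter.Eventually.of_forall fun U t _ => hC _ (Set.mem_univ _))
    (integrable_const C) (Filter.Eventually.of_forall fun U t _ => hder U t)).2
  have h0 : g 0 = 1 := by
    apply Subtype.ext
    simp [g, NormedSpace.exp_zero]
  -- By left invariance the integral of f(g t * U) does not depend on t, so its derivative at 0 is
  -- zero.
  simp only [integral_mul_left_eq_self f, h0, one_mul] at key
  exact key.unique (hasDerivAt_const (0 : ℝ) _)

/-- The Ward identity: infinitesimal left translations of a function integrate to zero. -/
theorem integral_leftDeriv (μ : Measure (Matrix.unitaryGroup n ℂ)) [IsFiniteMeasure μ]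
    [μ.IsMulLeftInvariant] {G : Matrix n n ℂ × Matrix n n ℂ → ℂ} (hG : ContDiff ℂ 1 G)
    (Y : Matrix n n ℂ) : ∫ U, leftDeriv G Y U ∂μ = 0 := by
  -- Complexification: Y = Y₁ + i Y₂ with both parts skew-Hermitian. Since G treats U and U† as
  -- independent holomorphic variables, `leftDeriv` is complex linear in Y, so the skew case extends
  -- to all directions, including nilpotent matrix units.
  let Y₁ : Matrix n n ℂ := (1 / 2 : ℂ) • (Y - Y.conjTranspose)
  let Y₂ : Matrix n n ℂ := (-Complex.I / 2 : ℂ) • (Y + Y.conjTranspose)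
  have h₁ : Y₁.conjTranspose = -Y₁ := by
    simp only [Y₁, Matrix.conjTranspose_smul, Matrix.conjTranspose_sub,
      Matrix.conjTranspose_conjTranspose]
    rw [← smul_neg, neg_sub]; simp
  have h₂ : Y₂.conjTranspose = -Y₂ := by
    simp only [Y₂, Matrix.conjTranspose_smul, Matrix.conjTranspose_add,
      Matrix.conjTranspose_conjTranspose]
    rw [← neg_smul, add_comm]
    congr 1
    simp [neg_div]
  have hYsum : Y = Y₁ + Complex.I • Y₂ := by
    simp only [Y₁, Y₂, smul_smul]
    have : Complex.I * (-Complex.I / 2) = 1 / 2 := by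
      rw [← mul_div_assoc, mul_neg, Complex.I_mul_I, neg_neg]
    rw [this, ← smul_add]
    ext i j; simp; ring
  clear_value Y₁ Y₂
  have hlin : ∀ U, leftDeriv G Y U = leftDeriv G Y₁ U + Complex.I * leftDeriv G Y₂ U := by
    intro U
    simp only [leftDeriv]
    rw [← smul_eq_mul Complex.I, ← map_smul, ← map_add]
    congr 1
    rw [Prod.smul_mk, Prod.mk_add_mk, hYsum]
    congr 1
    · rw [Matrix.add_mul, Matrix.smul_mul]
    · rw [Matrix.mul_add, Matrix.mul_smul, neg_add, smul_neg]
  simp_rw [hlin]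
  rw [integral_add (integrable_of_continuous_unitary (continuous_leftDeriv hG _))
    ((integrable_of_continuous_unitary (continuous_leftDeriv hG _)).const_mul _),
    integral_const_mul, integral_leftDeriv_of_skew μ hG h₁, integral_leftDeriv_of_skew μ hG h₂,
    mul_zero, add_zero]

end Ward

/-! ### Schwinger–Dyson polynomials away from the roots -/

section EvalSd

set_option linter.unusedSectionVars false

variable {σ : Type*} [Fintype σ] [DecidableEq σ]

lemma eval_genPoly (x : σ → ℝ) (z : ℝ) :
    MvPolynomial.eval x ((genPoly σ).eval (MvPolynomial.C z)) = ∏ i, (z - x i) := by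
  simp [genPoly, eval_prod]

lemma eval_genPolyErase (x : σ → ℝ) (z : ℝ) (i : σ) (hz : z ≠ x i) :
    MvPolynomial.eval x ((genPolyErase i).eval (MvPolynomial.C z)) =
      (∏ i, (z - x i)) * (z - x i)⁻¹ := by
  have : z - x i ≠ 0 := sub_ne_zero.2 hz
  rw [← Finset.mul_prod_erase _ _ (Finset.mem_univ i), mul_comm, inv_mul_cancel_left₀ this]
  simp [genPolyErase, eval_prod]

/-- Off the roots, p' and p'' are p times ∑ 1/(z-xᵢ) and (∑ 1/(z-xᵢ))² - ∑ 1/(z-xᵢ)². Written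
through these resolvent sums, the polynomial can be matched with traces of matrices. -/
lemma eval_sdPoly (x : σ → ℝ) (z : ℝ) (hz : ∀ i, z ≠ x i) (f : MvPolynomial σ ℝ) :
    MvPolynomial.eval x ((sdPoly f).eval (MvPolynomial.C z)) =
      MvPolynomial.eval x f * ((∏ i, (z - x i)) *
        (z * (1 - z) * ((∑ i, (z - x i)⁻¹) ^ 2 - ∑ i, ((z - x i)⁻¹) ^ 2) +
          (1 - 2 * z) * ∑ i, (z - x i)⁻¹ + (Fintype.card σ : ℝ) * (Fintype.card σ + 1))) +
      ∑ i, MvPolynomial.eval x (MvPolynomial.pderiv i f) * (x i * (1 - x i)) *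
        ((∏ i, (z - x i)) * (z - x i)⁻¹) := by
  have h1 : MvPolynomial.eval x ((derivative (genPoly σ)).eval (MvPolynomial.C z)) =
      (∏ i, (z - x i)) * ∑ i, (z - x i)⁻¹ := by
    rw [derivative_genPoly, eval_finsetSum, map_sum, Finset.mul_sum]
    exact Finset.sum_congr rfl fun i _ => eval_genPolyErase x z i (hz i)
  have h2 : MvPolynomial.eval x ((derivative (derivative (genPoly σ))).eval (MvPolynomial.C z)) =
      (∏ i, (z - x i)) * ((∑ i, (z - x i)⁻¹) ^ 2 - ∑ i, ((z - x i)⁻¹) ^ 2) := by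
    have : ∀ i, MvPolynomial.eval x ((derivative (genPolyErase i)).eval (MvPolynomial.C z)) =
        (∏ i, (z - x i)) * ((z - x i)⁻¹ * ((∑ j, (z - x j)⁻¹) - (z - x i)⁻¹)) := by
      intro i
      rw [derivative_genPolyErase, eval_finsetSum, map_sum,
        ← Finset.add_sum_erase _ _ (Finset.mem_univ i), add_sub_cancel_left, Finset.mul_sum,
        Finset.mul_sum]
      refine Finset.sum_congr rfl fun j hj => ?_
      have hi := sub_ne_zero.2 (hz i)
      have hj' := sub_ne_zero.2 (hz j)
      have := eval_genPolyErase x z i (hz i)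
      rw [genPolyErase_eq_mul (Finset.ne_of_mem_erase hj)] at this
      simp only [eval_mul, eval_sub, eval_X, eval_C, map_mul, map_sub, MvPolynomial.eval_C,
        MvPolynomial.eval_X] at this
      rw [← mul_right_inj' hj', this]
      field_simp
    rw [derivative_genPoly, derivative_sum, eval_finsetSum, map_sum,
      Finset.sum_congr rfl fun i _ => this i, ← Finset.mul_sum]
    congr 1
    rw [sq, Finset.sum_mul, ← Finset.sum_sub_distrib]
    exact Finset.sum_congr rfl fun i _ => by ring
  rw [sdPoly]
  simp only [eval_add, eval_mul, eval_sub, eval_X, eval_C, eval_one, eval_ofNat, eval_finsetSum,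
    eval_natCast, map_add, map_mul, map_sub, map_sum, map_one, map_ofNat, map_natCast, MvPolynomial.eval_C,
    MvPolynomial.eval_X, h1, h2, eval_genPoly]
  congr 1
  · ring
  · exact Finset.sum_congr rfl fun i _ => by rw [eval_genPolyErase x z i (hz i)]

lemma eval_pderiv_prod_genPoly {m : ℕ} (x : σ → ℝ) (y : Fin m → ℝ) (hy : ∀ l i, y l ≠ x i)
    (i : σ) :
    MvPolynomial.eval x (MvPolynomial.pderiv i
      (∏ l, (genPoly σ).eval (MvPolynomial.C (y l)) : MvPolynomial σ ℝ)) =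
    - ((∏ l, ∏ i, (y l - x i)) * ∑ l, (y l - x i)⁻¹) := by
  have h1 : ∀ l, MvPolynomial.eval x (MvPolynomial.pderiv i
      ((genPoly σ).eval (MvPolynomial.C (y l)) : MvPolynomial σ ℝ)) =
      - ((∏ i, (y l - x i)) * (y l - x i)⁻¹) := by
    intro l
    rw [← eval_genPolyErase x (y l) i (hy l i), genPoly_eq_mul i, eval_mul, Derivation.leibniz,
      pderiv_eval_genPolyErase]
    simp
  have h2 : ∀ s : Finset (Fin m), MvPolynomial.eval x (MvPolynomial.pderiv i
      (∏ l ∈ s, (genPoly σ).eval (MvPolynomial.C (y l)) : MvPolynomial σ ℝ)) =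
      - ((∏ l ∈ s, ∏ i, (y l - x i)) * ∑ l ∈ s, (y l - x i)⁻¹) := by
    intro s
    induction s using Finset.induction_on with
    | empty => simp
    | insert a s ha ih =>
      rw [Finset.prod_insert ha, Finset.prod_insert ha, Finset.sum_insert ha, Derivation.leibniz,
        map_add, smul_eq_mul, smul_eq_mul, map_mul, map_mul, ih, h1, map_prod, eval_genPoly]
      simp_rw [eval_genPoly]
      ring
  exact h2 Finset.univ

end EvalSd

/-! ### Derivatives of determinants and adjugates -/

section Calculus

set_option linter.unusedSectionVars false

attribute [local instance] Matrix.normedAddCommGroup Matrix.normedSpace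

variable {n : Type*} [Fintype n] [DecidableEq n]

lemma contDiff_det {E : Type*} [NormedAddCommGroup E] [NormedSpace ℂ E]
    {F : E → Matrix n n ℂ} (hF : ∀ i j, ContDiff ℂ 1 fun p => F p i j) :
    ContDiff ℂ 1 fun p => (F p).det := by
  simp only [Matrix.det_apply]
  exact ContDiff.sum fun σ _ => (contDiff_prod fun i _ => hF _ _).const_smul _

lemma contDiff_adjugate {E : Type*} [NormedAddCommGroup E] [NormedSpace ℂ E]
    {F : E → Matrix n n ℂ} (hF : ∀ i j, ContDiff ℂ 1 fun p => F p i j) (i j : n) :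
    ContDiff ℂ 1 fun p => (F p).adjugate i j := by
  simp only [Matrix.adjugate_apply]
  refine contDiff_det fun k l => ?_
  by_cases h : k = j
  · subst h; simpa using contDiff_const
  · simpa [Matrix.updateRow_ne h] using hF k l

lemma contDiff_mul {E : Type*} [NormedAddCommGroup E] [NormedSpace ℂ E]
    {F F' : E → Matrix n n ℂ} (hF : ∀ i j, ContDiff ℂ 1 fun p => F p i j)
    (hF' : ∀ i j, ContDiff ℂ 1 fun p => F' p i j) (i j : n) :
    ContDiff ℂ 1 fun p => (F p * F' p) i j := by
  simp only [Matrix.mul_apply]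
  exact ContDiff.sum fun k _ => (hF _ _).mul (hF' _ _)

lemma hasDerivAt_matrix_mul {F F' : ℂ → Matrix n n ℂ} {D D' : Matrix n n ℂ} {t : ℂ}
    (hF : ∀ i j, HasDerivAt (fun s => F s i j) (D i j) t)
    (hF' : ∀ i j, HasDerivAt (fun s => F' s i j) (D' i j) t) (i j : n) :
    HasDerivAt (fun s => (F s * F' s) i j) ((D * F' t + F t * D') i j) t := by
  simp only [Matrix.add_apply, Matrix.mul_apply, ← Finset.sum_add_distrib]
  exact HasDerivAt.fun_sum fun k _ => (hF _ _).mul (hF' _ _)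

lemma hasDerivAt_line (M D : Matrix n n ℂ) (i j : n) :
    HasDerivAt (fun t : ℂ => (M + t • D) i j) (D i j) 0 := by
  simpa using ((hasDerivAt_id (0 : ℂ)).mul_const (D i j)).const_add (M i j)

/-- Jacobi's formula at an invertible matrix. -/
lemma hasDerivAt_det_line {M : Matrix n n ℂ} (hM : M.det ≠ 0) (D : Matrix n n ℂ) :
    HasDerivAt (fun t : ℂ => (M + t • D).det) ((M.adjugate * D).trace) 0 := by
  have hM' : IsUnit M.det := isUnit_iff_ne_zero.2 hM
  -- p collects the terms of det(1 + t M⁻¹D) of order t² and higher, which do not affect the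
  -- derivative at 0.
  let p := (1 + (X : ℂ[X]) • (M⁻¹ * D).map C).det.divX.divX
  have h : ∀ t : ℂ, (M + t • D).det =
      M.det * (1 + (M⁻¹ * D).trace * t + p.eval t * t ^ 2) := by
    intro t
    rw [← Matrix.det_one_add_smul, ← Matrix.det_mul, Matrix.mul_add, Matrix.mul_one,
      Matrix.mul_smul, Matrix.mul_nonsing_inv_cancel_left _ _ hM']
  simp_rw [h]
  have hd := ((((hasDerivAt_id (0 : ℂ)).const_mul (M⁻¹ * D).trace).const_add 1).add
    ((p.hasDerivAt 0).mul (hasDerivAt_pow 2 (0 : ℂ)))).const_mul M.det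
  refine hd.congr_deriv ?_
  rw [Matrix.inv_def, Ring.inverse_eq_inv', Matrix.smul_mul, Matrix.trace_smul]
  simp [hM]

/-- Differentiability is clear because the entries are polynomial. Differentiating M · adj M = det M
· 1 and multiplying by adj M on the left then identifies the derivative. -/
lemma hasDerivAt_adjugate_line {M : Matrix n n ℂ} (hM : M.det ≠ 0) (D : Matrix n n ℂ) (i j : n) :
    HasDerivAt (fun t : ℂ => (M + t • D).adjugate i j)
      ((M.det⁻¹ • ((M.adjugate * D).trace • M.adjugate -
        M.adjugate * D * M.adjugate)) i j) 0 := by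
  have hc : ∀ i j, ContDiff ℂ 1 fun t : ℂ => (M + t • D) i j := fun i j => by
    simp only [Matrix.add_apply, Matrix.smul_apply, smul_eq_mul]
    exact contDiff_const.add (contDiff_id.mul contDiff_const)
  let Q' : Matrix n n ℂ := Matrix.of fun i j => deriv (fun t : ℂ => (M + t • D).adjugate i j) 0
  have hQ : ∀ i j, HasDerivAt (fun t : ℂ => (M + t • D).adjugate i j) (Q' i j) 0 := fun i j =>
    ((contDiff_adjugate hc i j).differentiable one_ne_zero 0).hasDerivAt
  have h1 : D * M.adjugate + M * Q' = (M.adjugate * D).trace • (1 : Matrix n n ℂ) := by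
    ext i j
    have a := hasDerivAt_matrix_mul (hasDerivAt_line M D) hQ i j
    have b := (hasDerivAt_det_line hM D).mul_const ((1 : Matrix n n ℂ) i j)
    simp only [Matrix.mul_adjugate, zero_smul, add_zero] at a
    exact a.unique b
  have h2 : M.det • Q' = M.adjugate * (M * Q') := by
    rw [← Matrix.mul_assoc, Matrix.adjugate_mul, Matrix.smul_mul, Matrix.one_mul]
  have h3 : Q' = M.det⁻¹ • ((M.adjugate * D).trace • M.adjugate -
      M.adjugate * D * M.adjugate) := by
    rw [eq_inv_smul_iff₀ hM, h2, eq_sub_iff_add_eq'.2 h1, Matrix.mul_sub, Matrix.mul_smul,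
      Matrix.mul_one, Matrix.mul_assoc]
  rw [← h3]
  exact hQ i j

lemma hasDerivAt_finset_prod' {ι : Type*} [DecidableEq ι] (s : Finset ι) {F : ι → ℂ → ℂ}
    {F' : ι → ℂ} {t : ℂ} (hF : ∀ l, HasDerivAt (F l) (F' l) t) (h0 : ∀ l, F l t ≠ 0) :
    HasDerivAt (fun s' => ∏ l ∈ s, F l s') ((∏ l ∈ s, F l t) * ∑ l ∈ s, (F l t)⁻¹ * F' l) t := by
  have := HasDerivAt.fun_finsetProd (u := s) fun l _ => hF l
  refine this.congr_deriv ?_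
  rw [Finset.mul_sum]
  refine Finset.sum_congr rfl fun l hl => ?_
  rw [← Finset.mul_prod_erase s _ hl, smul_eq_mul]
  have := h0 l
  field_simp

/-- The derivative of the test function along an elementary nilpotent direction. -/
lemma hasDerivAt_testFunction {m : ℕ} (A B A' B' : Matrix n n ℂ) (z : ℂ) (y : Fin m → ℂ)
    (hz : (z • (1 : Matrix n n ℂ) - A' * A).det ≠ 0)
    (hy : ∀ l, (y l • (1 : Matrix n n ℂ) - A' * A).det ≠ 0) (E : Matrix n n ℂ) (b a : n) :
    HasDerivAt (fun t : ℂ =>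
      ((B + t • (E * A)) * (z • 1 - (A' - t • (B' * E)) * A).adjugate * (A' - t • (B' * E))) b a *
        ∏ l, (y l • 1 - (A' - t • (B' * E)) * A).det)
      (((E * A * (z • 1 - A' * A).adjugate * A' +
          B * ((z • 1 - A' * A).det⁻¹ •
            (((z • 1 - A' * A).adjugate * (B' * E * A)).trace • (z • 1 - A' * A).adjugate -
              (z • 1 - A' * A).adjugate * (B' * E * A) * (z • 1 - A' * A).adjugate)) * A' -
          B * (z • 1 - A' * A).adjugate * (B' * E)) b a +
        (B * (z • 1 - A' * A).adjugate * A') b a *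
          ∑ l, (y l • 1 - A' * A).det⁻¹ *
            ((y l • 1 - A' * A).adjugate * (B' * E * A)).trace) *
        ∏ l, (y l • 1 - A' * A).det) 0 := by
  have e : ∀ w t : ℂ, w • (1 : Matrix n n ℂ) - (A' - t • (B' * E)) * A =
      (w • 1 - A' * A) + t • (B' * E * A) := by
    intro w t
    rw [Matrix.sub_mul, Matrix.smul_mul]; abel
  have e' : ∀ t : ℂ, A' - t • (B' * E) = A' + t • (-(B' * E)) := fun t => by
    rw [smul_neg, sub_eq_add_neg]
  simp only [e]
  simp only [e']
  have h1 := hasDerivAt_matrix_mul (hasDerivAt_matrix_mul (hasDerivAt_line B (E * A))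
    (hasDerivAt_adjugate_line hz (B' * E * A))) (hasDerivAt_line A' (-(B' * E))) b a
  have h2 := hasDerivAt_finset_prod' Finset.univ (F := fun l t =>
    (y l • 1 - A' * A + t • (B' * E * A)).det)
    (fun l => hasDerivAt_det_line (hy l) (B' * E * A)) (fun l => by simpa using hy l)
  refine (h1.mul h2).congr_deriv ?_
  simp only [zero_smul, add_zero]
  simp only [Matrix.add_apply, Matrix.sub_apply, Matrix.add_mul, Matrix.mul_neg, Matrix.neg_apply]
  ring

end Calculus

/-! ### Contraction over matrix units -/

section Trace

variable {n : Type*} [Fintype n] [DecidableEq n]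

lemma mul_single_mul_apply (P Q : Matrix n n ℂ) (b a c d : n) :
    (P * Matrix.single b a (1 : ℂ) * Q) c d = P c b * Q a d := by
  rw [Matrix.mul_assoc, Matrix.mul_apply, Finset.sum_eq_single b]
  · simp
  · intro k _ hk; simp [Matrix.single_mul_apply_of_ne _ _ _ _ _ hk]
  · simp

/-- A matrix unit splits a product into two entries, and summing over its indices contracts them
into traces. If an index does not occur in the remaining term, its sum gives the dimension. A matrix
unit already inside a trace reconnects with the outer entry into a single trace. -/
lemma sum_testFunction {m : ℕ} (A B A' B' : Matrix n n ℂ) (Q : Matrix n n ℂ)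
    (R : Fin m → Matrix n n ℂ) (r : ℂ) (d : Fin m → ℂ) :
    ∑ a, ∑ b, ((Matrix.single b a (1 : ℂ) * A * Q * A' +
          B * (r • ((Q * (B' * Matrix.single b a (1 : ℂ) * A)).trace • Q -
              Q * (B' * Matrix.single b a (1 : ℂ) * A) * Q)) * A' -
          B * Q * (B' * Matrix.single b a (1 : ℂ))) b a +
        (B * Q * A') b a *
          ∑ l, d l * (R l * (B' * Matrix.single b a (1 : ℂ) * A)).trace) =
      Fintype.card n * (Q * (A' * A)).trace - Fintype.card n * (Q * (B' * B)).trace +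
      r * ((Q * (B' * B) * Q * (A' * A)).trace -
        (Q * (B' * B)).trace * (Q * (A' * A)).trace) +
      ∑ l, d l * (R l * (B' * B) * Q * (A' * A)).trace := by
  have t1 : ∀ (P : Matrix n n ℂ) (a b : n), (P * (B' * Matrix.single b a (1 : ℂ) * A)).trace =
      (A * P * B') a b := by
    intro P a b
    rw [← Matrix.mul_assoc, ← Matrix.mul_assoc, Matrix.trace_mul_comm, ← Matrix.mul_assoc,
      ← Matrix.mul_assoc, Matrix.trace]
    simp only [Matrix.diag_apply]
    rw [Finset.sum_eq_single a]
    · simp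
    · intro k _ hk
      have := mul_single_mul_apply (A * P * B') 1 b a k k
      simpa [Matrix.one_apply_ne hk.symm] using this
    · simp
  have t2 : ∀ a b : n, (Matrix.single b a (1 : ℂ) * A * Q * A') b a = (A * Q * A') a a := by
    intro a b
    simp [Matrix.mul_assoc]
  have t3 : ∀ a b : n, (B * Q * (B' * Matrix.single b a (1 : ℂ))) b a = (B * Q * B') b b := by
    intro a b
    have := mul_single_mul_apply (B * Q * B') 1 b a b a
    simpa [Matrix.mul_assoc] using this
  have t4 : ∀ a b : n, (B * (Q * (B' * Matrix.single b a (1 : ℂ) * A) * Q) * A') b a =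
      (B * Q * B') b b * (A * Q * A') a a := by
    intro a b
    have := mul_single_mul_apply (B * Q * B') (A * Q * A') b a b a
    simpa [Matrix.mul_assoc] using this
  have t5 : ∀ P : Matrix n n ℂ, ∑ a, ∑ b, (A * P * B') a b * (B * Q * A') b a =
      (P * (B' * B) * Q * (A' * A)).trace := by
    intro P
    have : ∑ a, ∑ b, (A * P * B') a b * (B * Q * A') b a =
        ((A * P * B') * (B * Q * A')).trace := by
      simp only [Matrix.trace, Matrix.diag_apply, Matrix.mul_apply (M := A * P * B')]
    rw [this, Matrix.mul_assoc, Matrix.mul_assoc, Matrix.trace_mul_comm]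
    simp only [Matrix.mul_assoc]
  have t6 : ∑ a, (A * Q * A') a a = (Q * (A' * A)).trace := by
    change (A * Q * A').trace = _
    rw [Matrix.mul_assoc, Matrix.trace_mul_comm, Matrix.mul_assoc]
  have t7 : ∑ b, (B * Q * B') b b = (Q * (B' * B)).trace := by
    change (B * Q * B').trace = _
    rw [Matrix.mul_assoc, Matrix.trace_mul_comm, Matrix.mul_assoc]
  have t8 : ∀ a b : n, ((Matrix.single b a (1 : ℂ) * A * Q * A' +
          B * (r • ((Q * (B' * Matrix.single b a (1 : ℂ) * A)).trace • Q -
              Q * (B' * Matrix.single b a (1 : ℂ) * A) * Q)) * A' -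
          B * Q * (B' * Matrix.single b a (1 : ℂ))) b a +
        (B * Q * A') b a *
          ∑ l, d l * (R l * (B' * Matrix.single b a (1 : ℂ) * A)).trace) =
      (A * Q * A') a a - (B * Q * B') b b + r * ((A * Q * B') a b * (B * Q * A') b a -
        (B * Q * B') b b * (A * Q * A') a a) +
        ∑ l, d l * ((A * R l * B') a b * (B * Q * A') b a) := by
    intro a b
    rw [Matrix.sub_apply, Matrix.add_apply, t2, t3, Matrix.mul_smul, Matrix.smul_mul,
      Matrix.smul_apply, Matrix.mul_sub, Matrix.sub_mul, Matrix.sub_apply, t4, Matrix.mul_smul,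
      Matrix.smul_mul, Matrix.smul_apply, t1, Finset.mul_sum]
    simp only [t1, smul_eq_mul]
    rw [Finset.sum_congr rfl fun l _ => (by ring : (B * Q * A') b a * (d l * (A * R l * B') a b) =
      d l * ((A * R l * B') a b * (B * Q * A') b a))]
    ring
  simp only [t8, Finset.sum_add_distrib, Finset.sum_sub_distrib, ← Finset.mul_sum, t5]
  congr 1
  · congr 1
    · simp [Finset.sum_const, t6, t7, ← Finset.mul_sum]
    · rw [← t6, ← t7, Finset.sum_mul_sum, Finset.sum_comm]
  · rw [Finset.sum_congr rfl fun a _ => Finset.sum_comm, Finset.sum_comm]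
    refine Finset.sum_congr rfl fun l _ => ?_
    rw [← t5]
    simp only [Finset.mul_sum]

end Trace

/-! ### From traces to eigenvalues -/

section Spectral

variable {n : Type*} [Fintype n] [DecidableEq n]

lemma trace_conjStarAlgAut (S : Matrix.unitaryGroup n ℂ) (M : Matrix n n ℂ) :
    (Unitary.conjStarAlgAut ℂ (Matrix n n ℂ) S M).trace = M.trace := by
  rw [Unitary.conjStarAlgAut_apply, Matrix.trace_mul_comm, ← Matrix.mul_assoc,
    Unitary.coe_star_mul_self, Matrix.one_mul]

lemma det_conjStarAlgAut (S : Matrix.unitaryGroup n ℂ) (M : Matrix n n ℂ) :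
    (Unitary.conjStarAlgAut ℂ (Matrix n n ℂ) S M).det = M.det := by
  rw [Unitary.conjStarAlgAut_apply, Matrix.det_mul, mul_comm, ← Matrix.det_mul,
    ← Matrix.mul_assoc, Unitary.coe_star_mul_self, Matrix.one_mul]

variable {H : Matrix n n ℂ} (hH : H.IsHermitian)

lemma smul_one_sub_eq (z : ℝ) : (z : ℂ) • (1 : Matrix n n ℂ) - H =
    Unitary.conjStarAlgAut ℂ (Matrix n n ℂ) hH.eigenvectorUnitary
      (Matrix.diagonal fun i => ((z - hH.eigenvalues i : ℝ) : ℂ)) := by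
  conv_lhs => rw [hH.spectral_theorem]
  have : (z : ℂ) • (1 : Matrix n n ℂ) = Unitary.conjStarAlgAut ℂ (Matrix n n ℂ)
      hH.eigenvectorUnitary ((z : ℂ) • 1) := by rw [map_smul, map_one]
  rw [this, ← map_sub]
  congr 1
  ext i j
  by_cases h : i = j
  · subst h; simp
  · simp [h]

lemma det_smul_one_sub (z : ℝ) : ((z : ℂ) • (1 : Matrix n n ℂ) - H).det =
    ((∏ i, (z - hH.eigenvalues i) : ℝ) : ℂ) := by
  rw [smul_one_sub_eq hH, det_conjStarAlgAut, Matrix.det_diagonal, Complex.ofReal_prod]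

lemma adjugate_smul_one_sub (z : ℝ) (hz : ∀ i, z ≠ hH.eigenvalues i) :
    ((z : ℂ) • (1 : Matrix n n ℂ) - H).adjugate =
      Unitary.conjStarAlgAut ℂ (Matrix n n ℂ) hH.eigenvectorUnitary
        (Matrix.diagonal fun i =>
          (((∏ i, (z - hH.eigenvalues i)) * (z - hH.eigenvalues i)⁻¹ : ℝ) : ℂ)) := by
  have hdet : IsUnit ((z : ℂ) • (1 : Matrix n n ℂ) - H).det := by
    rw [det_smul_one_sub hH, isUnit_iff_ne_zero, Complex.ofReal_ne_zero]
    exact Finset.prod_ne_zero_iff.2 fun i _ => sub_ne_zero.2 (hz i)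
  have hU : IsUnit ((z : ℂ) • (1 : Matrix n n ℂ) - H) := (Matrix.isUnit_iff_isUnit_det _).2 hdet
  refine hU.mul_left_cancel ?_
  rw [Matrix.mul_adjugate, det_smul_one_sub hH]
  conv_rhs => rw [smul_one_sub_eq hH z, ← map_mul, Matrix.diagonal_mul_diagonal]
  have : (Matrix.diagonal fun i => ((z - hH.eigenvalues i : ℝ) : ℂ) *
      (((∏ i, (z - hH.eigenvalues i)) * (z - hH.eigenvalues i)⁻¹ : ℝ) : ℂ)) =
      ((∏ i, (z - hH.eigenvalues i) : ℝ) : ℂ) • (1 : Matrix n n ℂ) := by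
    rw [Matrix.smul_one_eq_diagonal]
    congr 1
    ext i
    rw [← Complex.ofReal_mul, mul_left_comm, mul_inv_cancel₀ (sub_ne_zero.2 (hz i)), mul_one]
  rw [this, map_smul, map_one]

/-- Partial fractions: x/(z-x) = z/(z-x) - 1 and (1-x)/(z-x) = (1-z)/(z-x) + 1. In the application c
is the determinant ∏ᵢ (z - xᵢ), so c/(z - xᵢ) are the eigenvalues of the adjugate. -/
lemma real_sd_identity {σ : Type*} [Fintype σ] (x : σ → ℝ) (z : ℝ) (hz : ∀ i, z ≠ x i) (c : ℝ)
    (hc : c ≠ 0) :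
    (Fintype.card σ : ℝ) * ∑ i, c * (z - x i)⁻¹ * x i -
      Fintype.card σ * ∑ i, c * (z - x i)⁻¹ * (1 - x i) +
      c⁻¹ * (∑ i, c * (z - x i)⁻¹ * (1 - x i) * (c * (z - x i)⁻¹) * x i -
        (∑ i, c * (z - x i)⁻¹ * (1 - x i)) * ∑ i, c * (z - x i)⁻¹ * x i) =
    - (c * (z * (1 - z) * ((∑ i, (z - x i)⁻¹) ^ 2 - ∑ i, ((z - x i)⁻¹) ^ 2) +
          (1 - 2 * z) * ∑ i, (z - x i)⁻¹ + (Fintype.card σ : ℝ) * (Fintype.card σ + 1))) := by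
  have h1 : ∑ i, c * (z - x i)⁻¹ * x i = c * (z * (∑ i, (z - x i)⁻¹) - Fintype.card σ) := by
    have : ∀ i, c * (z - x i)⁻¹ * x i = c * (z * (z - x i)⁻¹ - 1) := fun i => by
      have := sub_ne_zero.2 (hz i)
      field_simp; ring
    rw [Finset.sum_congr rfl fun i _ => this i, ← Finset.mul_sum, Finset.sum_sub_distrib,
      ← Finset.mul_sum]
    simp
  have h2 : ∑ i, c * (z - x i)⁻¹ * (1 - x i) =
      c * ((1 - z) * (∑ i, (z - x i)⁻¹) + Fintype.card σ) := by
    have : ∀ i, c * (z - x i)⁻¹ * (1 - x i) = c * ((1 - z) * (z - x i)⁻¹ + 1) := fun i => by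
      have := sub_ne_zero.2 (hz i)
      field_simp; ring
    rw [Finset.sum_congr rfl fun i _ => this i, ← Finset.mul_sum, Finset.sum_add_distrib,
      ← Finset.mul_sum]
    simp
  have h3 : ∑ i, c * (z - x i)⁻¹ * (1 - x i) * (c * (z - x i)⁻¹) * x i =
      c ^ 2 * (z * (1 - z) * (∑ i, ((z - x i)⁻¹) ^ 2) - (1 - 2 * z) * (∑ i, (z - x i)⁻¹)
        - Fintype.card σ) := by
    have : ∀ i, c * (z - x i)⁻¹ * (1 - x i) * (c * (z - x i)⁻¹) * x i =
        c ^ 2 * (z * (1 - z) * ((z - x i)⁻¹) ^ 2 - (1 - 2 * z) * (z - x i)⁻¹ - 1) := fun i => by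
      have := sub_ne_zero.2 (hz i)
      field_simp; ring
    rw [Finset.sum_congr rfl fun i _ => this i, ← Finset.mul_sum, Finset.sum_sub_distrib,
      Finset.sum_sub_distrib, ← Finset.mul_sum, ← Finset.mul_sum]
    simp
  rw [h1, h2, h3]
  field_simp
  ring

/-- The matrix form of the Schwinger–Dyson polynomial. -/
lemma trace_sd_identity {m : ℕ} (K : Matrix n n ℂ) (hK : K = 1 - H) (z : ℝ) (y : Fin m → ℝ)
    (hz : ∀ i, z ≠ hH.eigenvalues i) (hy : ∀ l i, y l ≠ hH.eigenvalues i) :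
    (Fintype.card n * (((z : ℂ) • (1 : Matrix n n ℂ) - H).adjugate * H).trace -
      Fintype.card n * (((z : ℂ) • (1 : Matrix n n ℂ) - H).adjugate * K).trace +
      ((z : ℂ) • (1 : Matrix n n ℂ) - H).det⁻¹ *
        ((((z : ℂ) • (1 : Matrix n n ℂ) - H).adjugate * K *
          ((z : ℂ) • (1 : Matrix n n ℂ) - H).adjugate * H).trace -
        (((z : ℂ) • (1 : Matrix n n ℂ) - H).adjugate * K).trace *
          (((z : ℂ) • (1 : Matrix n n ℂ) - H).adjugate * H).trace) +
      ∑ l, ((y l : ℂ) • (1 : Matrix n n ℂ) - H).det⁻¹ *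
        (((y l : ℂ) • (1 : Matrix n n ℂ) - H).adjugate * K *
          ((z : ℂ) • (1 : Matrix n n ℂ) - H).adjugate * H).trace) *
      ∏ l, ((y l : ℂ) • (1 : Matrix n n ℂ) - H).det =
    ((- MvPolynomial.eval hH.eigenvalues ((sdPoly (∏ l, (genPoly n).eval
      (MvPolynomial.C (y l)))).eval (MvPolynomial.C z)) : ℝ) : ℂ) := by
  set x := hH.eigenvalues with hx
  -- H, 1 - H and all the adjugates are diagonal in one eigenbasis of H, so every trace becomes a
  -- sum over eigenvalues.
  set T := Unitary.conjStarAlgAut ℂ (Matrix n n ℂ) hH.eigenvectorUnitary with hT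
  have hHT : H = T (Matrix.diagonal fun i => ((x i : ℝ) : ℂ)) := hH.spectral_theorem
  have hKT : K = T (Matrix.diagonal fun i => ((1 - x i : ℝ) : ℂ)) := by
    have := smul_one_sub_eq hH 1
    rw [Complex.ofReal_one, one_smul, ← hK] at this
    exact this
  have hadj : ∀ w : ℝ, (∀ i, w ≠ x i) → ((w : ℂ) • (1 : Matrix n n ℂ) - H).adjugate =
      T (Matrix.diagonal fun i => (((∏ i, (w - x i)) * (w - x i)⁻¹ : ℝ) : ℂ)) := fun w hw =>
    adjugate_smul_one_sub hH w hw
  have hdet : ∀ w : ℝ, ((w : ℂ) • (1 : Matrix n n ℂ) - H).det = ((∏ i, (w - x i) : ℝ) : ℂ) :=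
    fun w => det_smul_one_sub hH w
  have htr : ∀ d : n → ℝ, (T (Matrix.diagonal fun i => ((d i : ℝ) : ℂ))).trace =
      ((∑ i, d i : ℝ) : ℂ) := fun d => by
    rw [hT, trace_conjStarAlgAut, Matrix.trace_diagonal, Complex.ofReal_sum]
  have hmul : ∀ d d' : n → ℝ, T (Matrix.diagonal fun i => ((d i : ℝ) : ℂ)) *
      T (Matrix.diagonal fun i => ((d' i : ℝ) : ℂ)) =
      T (Matrix.diagonal fun i => ((d i * d' i : ℝ) : ℂ)) := fun d d' => by
    rw [← map_mul, Matrix.diagonal_mul_diagonal]; simp only [Complex.ofReal_mul]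
  have hcz : ∏ i, (z - x i) ≠ 0 := Finset.prod_ne_zero_iff.2 fun i _ => sub_ne_zero.2 (hz i)
  have hcy : ∀ l, ∏ i, (y l - x i) ≠ 0 := fun l =>
    Finset.prod_ne_zero_iff.2 fun i _ => sub_ne_zero.2 (hy l i)
  simp only [hdet, hadj z hz, fun l => hadj (y l) (hy l)]
  rw [hKT]
  conv_lhs => rw [hHT]
  simp only [hmul, htr]
  rw [eval_sdPoly x z hz]
  simp only [eval_pderiv_prod_genPoly x y hy, map_prod, eval_genPoly]
  norm_cast
  have key := real_sd_identity x z hz _ hcz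
  rw [key]
  have hl : ∀ l, (∏ i, (y l - x i))⁻¹ * ∑ i, (∏ i, (y l - x i)) * (y l - x i)⁻¹ * (1 - x i) *
      ((∏ i, (z - x i)) * (z - x i)⁻¹) * x i =
      ∑ i, (y l - x i)⁻¹ * ((x i * (1 - x i)) * ((∏ i, (z - x i)) * (z - x i)⁻¹)) := by
    intro l
    rw [Finset.mul_sum]
    refine Finset.sum_congr rfl fun i _ => ?_
    have := hcy l
    field_simp
  simp only [hl]
  rw [Finset.sum_comm]
  simp only [← Finset.sum_mul, neg_mul, mul_assoc, Finset.sum_neg_distrib, ← Finset.mul_sum]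
  push_cast
  ring

end Spectral

/-! ### Schwinger–Dyson equations for Haar unitaries -/

section Haar

variable {N : ℕ}

/-- The lower left block. -/
def lowerBlock (U : Matrix.unitaryGroup (Fin 2 × Fin N) ℂ) : Matrix (Fin N) (Fin N) ℂ :=
  (U : Matrix (Fin 2 × Fin N) (Fin 2 × Fin N) ℂ).submatrix (fun i => (1, i)) (fun j => (0, j))

/-- The first N columns of U are orthonormal. Because there are only two blocks, B†B is a function
of A†A, which closes the equations on the eigenvalues. -/
lemma conjTranspose_lowerBlock_mul (U : Matrix.unitaryGroup (Fin 2 × Fin N) ℂ) :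
    (lowerBlock U).conjTranspose * lowerBlock U =
      1 - (block U).conjTranspose * block U := by
  have h := Matrix.mem_unitaryGroup_iff'.1 U.2
  rw [eq_sub_iff_add_eq]
  ext i j
  have := congrFun (congrFun h (0, i)) (0, j)
  rw [Matrix.mul_apply, Fintype.sum_prod_type, Fin.sum_univ_two] at this
  simp only [Matrix.add_apply, Matrix.mul_apply, Matrix.conjTranspose_apply, lowerBlock, block,
    Matrix.submatrix_apply, Matrix.star_apply] at this ⊢
  rw [add_comm, this]
  simp [Matrix.one_apply]

open scoped ComplexOrder in
lemma eigenvalues_nonneg (U : Matrix.unitaryGroup (Fin 2 × Fin N) ℂ) (i : Fin N) :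
    0 ≤ eigenvalues U i :=
  (Matrix.posSemidef_conjTranspose_mul_self (block U)).eigenvalues_nonneg i

-- 1 - A†A = B†B is positive semidefinite; diagonalizing it shows 1 minus each eigenvalue on the
-- diagonal.
open scoped ComplexOrder in
lemma eigenvalues_le_one (U : Matrix.unitaryGroup (Fin 2 × Fin N) ℂ) (i : Fin N) :
    eigenvalues U i ≤ 1 := by
  set hH := Matrix.isHermitian_conjTranspose_mul_self (block U) with hHdef
  have h := smul_one_sub_eq hH 1
  rw [Complex.ofReal_one, one_smul, ← conjTranspose_lowerBlock_mul] at h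
  have hp := (Matrix.posSemidef_conjTranspose_mul_self (lowerBlock U)).conjTranspose_mul_mul_same
    (hH.eigenvectorUnitary : Matrix (Fin N) (Fin N) ℂ)
  rw [h, Unitary.conjStarAlgAut_apply] at hp
  have e : ((hH.eigenvectorUnitary : Matrix (Fin N) (Fin N) ℂ)).conjTranspose *
      hH.eigenvectorUnitary = 1 := Unitary.coe_star_mul_self hH.eigenvectorUnitary
  rw [Matrix.star_eq_conjTranspose, Matrix.mul_assoc _ (_ * _) (_ : Matrix _ _ _),
    Matrix.mul_assoc (_ * _), e, Matrix.mul_one, ← Matrix.mul_assoc, e, Matrix.one_mul,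
    Matrix.posSemidef_diagonal_iff] at hp
  have := hp i
  rw [Complex.zero_le_real] at this
  linarith [this, show hH.eigenvalues i = eigenvalues U i from rfl]

attribute [local instance] Matrix.normedAddCommGroup Matrix.normedSpace

/-- The test functions for the Ward identity. -/
def testFunction {m : ℕ} (z : ℝ) (y : Fin m → ℝ) (a b : Fin N)
    (p : Matrix (Fin 2 × Fin N) (Fin 2 × Fin N) ℂ × Matrix (Fin 2 × Fin N) (Fin 2 × Fin N) ℂ) :
    ℂ :=
  (p.1.submatrix (fun i => (1, i)) (fun j => (0, j)) *
    ((z : ℂ) • 1 - p.2.submatrix (fun i => (0, i)) (fun j => (0, j)) *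
      p.1.submatrix (fun i => (0, i)) (fun j => (0, j))).adjugate *
    p.2.submatrix (fun i => (0, i)) (fun j => (0, j)) : Matrix (Fin N) (Fin N) ℂ) b a *
  ∏ l, ((y l : ℂ) • (1 : Matrix (Fin N) (Fin N) ℂ) -
    p.2.submatrix (fun i => (0, i)) (fun j => (0, j)) *
      p.1.submatrix (fun i => (0, i)) (fun j => (0, j))).det

lemma contDiff_testFunction {m : ℕ} (z : ℝ) (y : Fin m → ℝ) (a b : Fin N) :
    ContDiff ℂ 1 (testFunction z y a b) := by
  have h1 : ∀ i j : Fin 2 × Fin N, ContDiff ℂ 1 fun p :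
      Matrix (Fin 2 × Fin N) (Fin 2 × Fin N) ℂ × Matrix (Fin 2 × Fin N) (Fin 2 × Fin N) ℂ =>
      p.1 i j := fun i j =>
    ((Matrix.entryLinearMap ℂ ℂ i j).toContinuousLinearMap.contDiff).comp contDiff_fst
  have h2 : ∀ i j : Fin 2 × Fin N, ContDiff ℂ 1 fun p :
      Matrix (Fin 2 × Fin N) (Fin 2 × Fin N) ℂ × Matrix (Fin 2 × Fin N) (Fin 2 × Fin N) ℂ =>
      p.2 i j := fun i j =>
    ((Matrix.entryLinearMap ℂ ℂ i j).toContinuousLinearMap.contDiff).comp contDiff_snd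
  have h3 : ∀ (w : ℂ) (i j : Fin N), ContDiff ℂ 1 fun p :
      Matrix (Fin 2 × Fin N) (Fin 2 × Fin N) ℂ × Matrix (Fin 2 × Fin N) (Fin 2 × Fin N) ℂ =>
      (w • (1 : Matrix (Fin N) (Fin N) ℂ) - p.2.submatrix (fun i => (0, i)) (fun j => (0, j)) *
      p.1.submatrix (fun i => (0, i)) (fun j => (0, j))) i j := fun w i j =>
    contDiff_const.sub (contDiff_mul (fun i j => h2 (0, i) (0, j)) (fun i j => h1 (0, i) (0, j)) i j)
  exact (contDiff_mul (contDiff_mul (fun i j => h1 (1, i) (0, j)) (contDiff_adjugate (h3 _)))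
    (fun i j => h2 (0, i) (0, j)) b a).mul (contDiff_prod fun l _ => contDiff_det (h3 _))

/-- Left translation by this matrix unit adds a multiple of a row of the upper block to a row of the
lower one. With U and U† independent, B becomes B + tEA and A† becomes A† - tB†E, while A and B†
stay fixed. -/
lemma leftDeriv_testFunction {m : ℕ} (z : ℝ) (y : Fin m → ℝ)
    (U : Matrix.unitaryGroup (Fin 2 × Fin N) ℂ) (hz : ∀ i, z ≠ eigenvalues U i)
    (hy : ∀ l i, y l ≠ eigenvalues U i) (a b : Fin N) :
    leftDeriv (testFunction z y a b) (Matrix.single (1, b) (0, a) 1) U =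
      (fun A B A' B' E : Matrix (Fin N) (Fin N) ℂ =>
        ((E * A * ((z : ℂ) • 1 - A' * A).adjugate * A' +
          B * (((z : ℂ) • 1 - A' * A).det⁻¹ •
            ((((z : ℂ) • 1 - A' * A).adjugate * (B' * E * A)).trace •
              ((z : ℂ) • 1 - A' * A).adjugate -
              ((z : ℂ) • 1 - A' * A).adjugate * (B' * E * A) *
                ((z : ℂ) • 1 - A' * A).adjugate)) * A' -
          B * ((z : ℂ) • 1 - A' * A).adjugate * (B' * E)) b a +
        (B * ((z : ℂ) • 1 - A' * A).adjugate * A') b a *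
          ∑ l, ((y l : ℂ) • 1 - A' * A).det⁻¹ *
            (((y l : ℂ) • 1 - A' * A).adjugate * (B' * E * A)).trace) *
        ∏ l, ((y l : ℂ) • 1 - A' * A).det)
      (block U) (lowerBlock U) (block U).conjTranspose (lowerBlock U).conjTranspose
      (Matrix.single b a 1) := by
  have hdet : ∀ w : ℝ, (∀ i, w ≠ eigenvalues U i) →
      ((w : ℂ) • (1 : Matrix (Fin N) (Fin N) ℂ) - (block U).conjTranspose * block U).det ≠ 0 := by
    intro w hw
    rw [det_smul_one_sub (Matrix.isHermitian_conjTranspose_mul_self (block U)),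
      Complex.ofReal_ne_zero]
    exact Finset.prod_ne_zero_iff.2 fun i _ => sub_ne_zero.2 (hw i)
  have h := hasDerivAt_testFunction (block U) (lowerBlock U) (block U).conjTranspose
    (lowerBlock U).conjTranspose (z : ℂ) (fun l => (y l : ℂ)) (hdet z hz)
    (fun l => hdet (y l) (hy l)) (Matrix.single b a 1) b a
  set V : Matrix (Fin 2 × Fin N) (Fin 2 × Fin N) ℂ := U.1 with hV
  set E : Matrix (Fin 2 × Fin N) (Fin 2 × Fin N) ℂ := Matrix.single (1, b) (0, a) 1 with hE
  have hpath : HasDerivAt (fun t : ℂ => ((V, V.conjTranspose) :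
      Matrix (Fin 2 × Fin N) (Fin 2 × Fin N) ℂ × Matrix (Fin 2 × Fin N) (Fin 2 × Fin N) ℂ) +
      t • (E * V, -(V.conjTranspose * E))) (E * V, -(V.conjTranspose * E)) 0 := by
    exact (((hasDerivAt_id (0 : ℂ)).smul_const (E * V, -(V.conjTranspose * E))).const_add
      (V, V.conjTranspose)).congr_deriv (one_smul _ _)
  have hG : HasFDerivAt (testFunction z y a b) (fderiv ℂ (testFunction z y a b)
      (V, V.conjTranspose)) ((V, V.conjTranspose) + (0 : ℂ) • (E * V, -(V.conjTranspose * E))) := by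
    rw [zero_smul, add_zero]
    exact ((contDiff_testFunction z y a b).differentiable one_ne_zero _).hasFDerivAt
  have h' := hG.comp_hasDerivAt (0 : ℂ) hpath
  refine h'.unique ?_
  refine h.congr_of_eventuallyEq (Filter.Eventually.of_forall fun t => ?_)
  have e1 : (V + t • (E * V)).submatrix (fun i : Fin N => ((1 : Fin 2), i))
      (fun j : Fin N => ((0 : Fin 2), j)) =
      lowerBlock U + t • (Matrix.single b a 1 * block U) := by
    ext i j
    simp only [Matrix.submatrix_apply, Matrix.add_apply, Matrix.smul_apply, hE]
    by_cases hi : i = b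
    · subst hi
      simp [lowerBlock, block, hV]
    · rw [Matrix.single_mul_apply_of_ne _ _ _ _ _ (by simpa using hi),
        Matrix.single_mul_apply_of_ne _ _ _ _ _ hi]
      rfl
  have e2 : (V + t • (E * V)).submatrix (fun i : Fin N => ((0 : Fin 2), i))
      (fun j : Fin N => ((0 : Fin 2), j)) = block U := by
    ext i j
    simp only [Matrix.submatrix_apply, Matrix.add_apply, Matrix.smul_apply, hE]
    rw [Matrix.single_mul_apply_of_ne _ _ _ _ _ (by simp)]
    simp [block, hV]
  have e3 : (V.conjTranspose + t • (-(V.conjTranspose * E))).submatrix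
      (fun i : Fin N => ((0 : Fin 2), i)) (fun j : Fin N => ((0 : Fin 2), j)) =
      (block U).conjTranspose - t • ((lowerBlock U).conjTranspose * Matrix.single b a 1) := by
    ext i j
    simp only [Matrix.submatrix_apply, Matrix.sub_apply, Matrix.smul_apply, hE, smul_neg, ← sub_eq_add_neg]
    by_cases hj : j = a
    · subst hj
      simp [lowerBlock, block, hV]
    · rw [Matrix.mul_single_apply_of_ne _ _ _ _ _ (by simpa using hj),
        Matrix.mul_single_apply_of_ne _ _ _ _ _ hj]
      rfl
  simp only [Function.comp_apply, testFunction, Prod.smul_mk, Prod.mk_add_mk, e1, e2, e3]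

lemma sum_leftDeriv_testFunction {m : ℕ} (z : ℝ) (y : Fin m → ℝ)
    (U : Matrix.unitaryGroup (Fin 2 × Fin N) ℂ) (hz : ∀ i, z ≠ eigenvalues U i)
    (hy : ∀ l i, y l ≠ eigenvalues U i) :
    ∑ a, ∑ b, leftDeriv (testFunction z y a b) (Matrix.single (1, b) (0, a) 1) U =
      ((- MvPolynomial.eval (eigenvalues U) ((sdPoly (∏ l, (genPoly (Fin N)).eval
        (MvPolynomial.C (y l)))).eval (MvPolynomial.C z)) : ℝ) : ℂ) := by
  simp only [leftDeriv_testFunction z y U hz hy, ← Finset.sum_mul]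
  rw [sum_testFunction]
  exact trace_sd_identity (Matrix.isHermitian_conjTranspose_mul_self (block U)) _
    (conjTranspose_lowerBlock_mul U) z y hz hy

theorem integral_sdPoly_prod (μ : Measure (Matrix.unitaryGroup (Fin 2 × Fin N) ℂ))
    [IsFiniteMeasure μ] [μ.IsMulLeftInvariant] {m : ℕ} (z : ℝ) (hz : 1 < z) (y : Fin m → ℝ)
    (hy : ∀ l, 1 < y l) :
    ∫ U, MvPolynomial.eval (eigenvalues U) ((sdPoly (∏ l, (genPoly (Fin N)).eval
        (MvPolynomial.C (y l)))).eval (MvPolynomial.C z)) ∂μ = 0 := by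
  have h : ∫ U, ∑ a, ∑ b, leftDeriv (testFunction z y a b)
      (Matrix.single ((1 : Fin 2), b) ((0 : Fin 2), a) (1 : ℂ)) U ∂μ = 0 := by
    have hi : ∀ a b : Fin N, Integrable (leftDeriv (testFunction z y a b)
        (Matrix.single ((1 : Fin 2), b) ((0 : Fin 2), a) (1 : ℂ))) μ := fun a b =>
      integrable_of_continuous_unitary (continuous_leftDeriv (contDiff_testFunction z y a b) _)
    rw [integral_finsetSum _ fun a _ => integrable_finsetSum _ fun b _ => hi a b]
    refine Finset.sum_eq_zero fun a _ => ?_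
    rw [integral_finsetSum _ fun b _ => hi a b]
    exact Finset.sum_eq_zero fun b _ => integral_leftDeriv μ (contDiff_testFunction z y a b) _
  -- Parameters above 1 avoid all eigenvalues of every U at once, so the pointwise formula holds
  -- under the integral.
  have hne : ∀ (w : ℝ), 1 < w → ∀ (U : Matrix.unitaryGroup (Fin 2 × Fin N) ℂ) i,
      w ≠ eigenvalues U i := fun w hw U i => ((eigenvalues_le_one U i).trans_lt hw).ne'
  simp_rw [fun U => sum_leftDeriv_testFunction z y U (hne z hz U) fun l => hne _ (hy l) U] at h
  rw [integral_complex_ofReal, Complex.ofReal_eq_zero, integral_neg, neg_eq_zero] at h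
  exact h

end Haar

/-! ### Measurability of the eigenvalues -/

section Measurability

variable {N : ℕ}

lemma sum_eigenvalues_pow (U : Matrix.unitaryGroup (Fin 2 × Fin N) ℂ) (k : ℕ) :
    ∑ i, eigenvalues U i ^ k = ((((block U).conjTranspose * block U) ^ k).trace).re := by
  have hH := Matrix.isHermitian_conjTranspose_mul_self (block U)
  have : (((block U).conjTranspose * block U) ^ k).trace =
      ((∑ i, eigenvalues U i ^ k : ℝ) : ℂ) := by
    conv_lhs => rw [hH.spectral_theorem]
    rw [← map_pow, trace_conjStarAlgAut, Matrix.diagonal_pow, Matrix.trace_diagonal]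
    push_cast
    rfl
  rw [this, Complex.ofReal_re]

lemma continuous_block : Continuous
    (block : Matrix.unitaryGroup (Fin 2 × Fin N) ℂ → Matrix (Fin N) (Fin N) ℂ) :=
  continuous_subtype_val.matrix_submatrix _ _

lemma continuous_sum_eval_eigenvalues (p : ℝ[X]) : Continuous
    fun U : Matrix.unitaryGroup (Fin 2 × Fin N) ℂ => ∑ i, p.eval (eigenvalues U i) := by
  simp_rw [eval_eq_sum_range]
  have : (fun U : Matrix.unitaryGroup (Fin 2 × Fin N) ℂ =>
      ∑ i, ∑ k ∈ Finset.range (p.natDegree + 1), p.coeff k * eigenvalues U i ^ k) =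
      fun U => ∑ k ∈ Finset.range (p.natDegree + 1), p.coeff k *
        ((((block U).conjTranspose * block U) ^ k).trace).re := by
    ext U
    rw [Finset.sum_comm]
    simp_rw [← Finset.mul_sum, sum_eigenvalues_pow]
  rw [this]
  refine continuous_finsetSum _ fun k _ => continuous_const.mul
    (Complex.continuous_re.comp (Continuous.matrix_trace ?_))
  exact (continuous_block.matrix_conjTranspose.matrix_mul continuous_block).pow k

/-- Polynomial sums are continuous in U, being traces of powers of A†A. Since the eigenvalues lie in
[0,1], Weierstrass approximation there gives the general h as a pointwise limit. -/
lemma measurable_sum_continuous_eigenvalues {h : ℝ → ℝ} (hh : Continuous h) : Measurable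
    fun U : Matrix.unitaryGroup (Fin 2 × Fin N) ℂ => ∑ i, h (eigenvalues U i) := by
  choose p hp using fun k : ℕ => exists_polynomial_near_of_continuousOn 0 1 h hh.continuousOn
    (1 / ((k : ℝ) + 1)) (by positivity)
  refine measurable_of_tendsto_metrizable
    (fun k => (continuous_sum_eval_eigenvalues (p k)).measurable) (tendsto_pi_nhds.2 fun U => ?_)
  refine tendsto_finsetSum _ fun i _ => ?_
  rw [tendsto_iff_dist_tendsto_zero]
  refine squeeze_zero (fun _ => dist_nonneg) (fun k => ?_)
    (tendsto_one_div_add_atTop_nhds_zero_nat (𝕜 := ℝ))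
  rw [Real.dist_eq]
  exact (hp k _ ⟨eigenvalues_nonneg U i, eigenvalues_le_one U i⟩).le

lemma measurable_card_eigenvalues (c : ℝ) : Measurable
    fun U : Matrix.unitaryGroup (Fin 2 × Fin N) ℂ =>
      ((Finset.univ.filter fun i => c < eigenvalues U i).card : ℝ) := by
  have : (fun U : Matrix.unitaryGroup (Fin 2 × Fin N) ℂ =>
      ((Finset.univ.filter fun i => c < eigenvalues U i).card : ℝ)) =
      fun U => ∑ i, if c < eigenvalues U i then (1 : ℝ) else 0 := by
    ext U; simp
  rw [this]
  -- The continuous ramps min(1, k (x - c)⁺) converge pointwise to the indicator of x > c.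
  refine measurable_of_tendsto_metrizable (f := fun (k : ℕ) U =>
    ∑ i, min 1 ((k : ℝ) * max (eigenvalues U i - c) 0))
    (fun k => measurable_sum_continuous_eigenvalues
      (h := fun x => min 1 ((k : ℝ) * max (x - c) 0)) (by fun_prop))
    (tendsto_pi_nhds.2 fun U => tendsto_finsetSum _ fun i _ => ?_)
  split_ifs with h
  · refine tendsto_const_nhds.congr' ?_
    obtain ⟨k₀, hk₀⟩ := exists_nat_gt (eigenvalues U i - c)⁻¹
    filter_upwards [Filter.eventually_ge_atTop k₀] with k hk
    have h' : 0 < eigenvalues U i - c := sub_pos.2 h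
    rw [max_eq_left h'.le, min_eq_left]
    have : (eigenvalues U i - c)⁻¹ ≤ k := hk₀.le.trans (by exact_mod_cast hk)
    calc (1 : ℝ) = (eigenvalues U i - c)⁻¹ * (eigenvalues U i - c) := by field_simp
      _ ≤ _ := by gcongr
  · refine tendsto_const_nhds.congr fun k => ?_
    rw [max_eq_right (by linarith), mul_zero, min_eq_right zero_le_one]

/-- This turns an event about one ordered eigenvalue into a count, which is a symmetric function of
the spectrum. -/
lemma lt_apply_iff_of_antitone {M : ℕ} {f : Fin M → ℝ} (hf : Antitone f) (c : ℝ) (k : Fin M) :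
    c < f k ↔ (k : ℕ) < (Finset.univ.filter fun j => c < f j).card := by
  constructor
  · intro h
    have : Finset.Iic k ⊆ Finset.univ.filter fun j => c < f j := fun j hj => by
      simpa using h.trans_le (hf (Finset.mem_Iic.1 hj))
    have := Finset.card_le_card this
    rw [Fin.card_Iic] at this
    omega
  · intro h
    by_contra hc
    have : (Finset.univ.filter fun j => c < f j) ⊆ Finset.Iio k := fun j hj => by
      rw [Finset.mem_Iio]
      by_contra hj'
      exact hc ((Finset.mem_filter.1 hj).2.trans_le (hf (not_lt.1 hj')))
    have := Finset.card_le_card this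
    rw [Fin.card_Iio] at this
    omega

lemma measurable_eigenvalues : Measurable
    (eigenvalues : Matrix.unitaryGroup (Fin 2 × Fin N) ℂ → Fin N → ℝ) := by
  refine measurable_pi_lambda _ fun i => measurable_of_Ioi fun c => ?_
  -- This must be the relabeling built into `Matrix.IsHermitian.eigenvalues`, so that passing to the
  -- sorted `eigenvalues₀` is definitional.
  let e : Fin (Fintype.card (Fin N)) ≃ Fin N := Fintype.equivOfCardEq (Fintype.card_fin _)
  have : (fun U : Matrix.unitaryGroup (Fin 2 × Fin N) ℂ => eigenvalues U i) ⁻¹' Set.Ioi c =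
      (fun U : Matrix.unitaryGroup (Fin 2 × Fin N) ℂ =>
        ((Finset.univ.filter fun i => c < eigenvalues U i).card : ℝ)) ⁻¹'
        Set.Ioi (((e.symm i : Fin _) : ℕ) : ℝ) := by
    ext U
    simp only [Set.mem_preimage, Set.mem_Ioi, Nat.cast_lt]
    have hH := Matrix.isHermitian_conjTranspose_mul_self (block U)
    have h := lt_apply_iff_of_antitone hH.eigenvalues₀_antitone c (e.symm i)
    have hcard : (Finset.univ.filter fun j => c < hH.eigenvalues₀ j).card =
        (Finset.univ.filter fun i => c < eigenvalues U i).card := by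
      refine Finset.card_equiv e fun j => ?_
      simp only [Finset.mem_filter, Finset.mem_univ, true_and]
      change c < _ ↔ c < hH.eigenvalues₀ (e.symm (e j))
      rw [Equiv.symm_apply_apply]
    rw [hcard] at h
    exact h
  rw [this]
  exact measurable_card_eigenvalues c measurableSet_Ioi

end Measurability

/-! ### Generators of the symmetric polynomials -/

section Symmetric

set_option linter.unusedSectionVars false

variable {σ : Type*} [Fintype σ] [DecidableEq σ]

/-- The fundamental theorem of symmetric polynomials, since by Vieta the coefficients of the generic
polynomial are the elementary symmetric polynomials up to sign. -/
lemma mem_coeffAlgebra_of_isSymmetric {f : MvPolynomial σ ℝ} (hf : f.IsSymmetric) :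
    f ∈ coeffAlgebra σ := by
  have hes : ∀ j ≤ Fintype.card σ, MvPolynomial.esymm σ ℝ j ∈ coeffAlgebra σ := by
    intro j hj
    have h := Multiset.prod_X_sub_C_coeff
      ((Finset.univ : Finset σ).val.map (MvPolynomial.X : σ → MvPolynomial σ ℝ))
      (k := Fintype.card σ - j) (by simp)
    rw [Multiset.map_map, Multiset.card_map, ← Finset.card_def, Finset.card_univ,
      Nat.sub_sub_self hj, ← MvPolynomial.esymm_eq_multiset_esymm] at h
    have h' : genCoeff σ (Fintype.card σ - j) = (-1) ^ j * MvPolynomial.esymm σ ℝ j := h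
    have e : MvPolynomial.esymm σ ℝ j = (-1) ^ j * genCoeff σ (Fintype.card σ - j) := by
      rw [h', ← mul_assoc, ← mul_pow]; simp
    rw [e]
    exact mul_mem (pow_mem (neg_mem (one_mem _)) _) (Algebra.subset_adjoin ⟨_, rfl⟩)
  obtain ⟨p, hp⟩ := MvPolynomial.esymmAlgHom_surjective (σ := σ) ℝ le_rfl ⟨f, hf⟩
  have hp' := congrArg Subtype.val hp
  rw [MvPolynomial.esymmAlgHom_apply] at hp'
  change _ = f at hp'
  rw [← hp']
  have hr : MvPolynomial.aeval (fun i : Fin (Fintype.card σ) => MvPolynomial.esymm σ ℝ (i + 1)) p ∈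
      Algebra.adjoin ℝ (Set.range fun i : Fin (Fintype.card σ) =>
        MvPolynomial.esymm σ ℝ (i + 1)) := by
    rw [Algebra.adjoin_range_eq_range_aeval]
    exact ⟨p, rfl⟩
  refine Algebra.adjoin_le ?_ hr
  rintro _ ⟨i, rfl⟩
  exact hes _ i.2

/-- By duality: a functional that kills p(y) for all y > 1 kills all coefficients of p. This plays
the role of interpolation. -/
lemma genCoeff_mem_span_eval (k : ℕ) : genCoeff σ k ∈ Submodule.span ℝ
    ((fun y : ℝ => (genPoly σ).eval (MvPolynomial.C y)) '' Set.Ioi 1) := by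
  by_contra h
  obtain ⟨δ, hδ, hS⟩ := Submodule.exists_le_ker_of_notMem h
  refine hδ (apply_coeff_eq_zero δ (genPoly σ) (Set.Ioi_infinite (1 : ℝ)) (fun z hz => ?_) k)
  exact hS (Submodule.subset_span ⟨z, hz, rfl⟩)

/-- Reduces linear statements about symmetric polynomials to the products ∏ₗ p(yₗ) with yₗ > 1, the
test functions available on the Haar side. -/
lemma coeffAlgebra_le_span : (coeffAlgebra σ).toSubmodule ≤ Submodule.span ℝ
    (Submonoid.closure ((fun y : ℝ => (genPoly σ).eval (MvPolynomial.C y)) '' Set.Ioi 1) :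
      Set (MvPolynomial σ ℝ)) := by
  rw [← Algebra.adjoin_eq_span]
  refine Algebra.adjoin_le ?_
  rintro _ ⟨k, rfl⟩
  exact Algebra.span_le_adjoin ℝ _ (genCoeff_mem_span_eval k)

end Symmetric

/-! ### Symmetric moments of the Haar eigenvalues -/

section HaarFunctional

variable {N : ℕ}

lemma eigenvalues_mem_Icc (U : Matrix.unitaryGroup (Fin 2 × Fin N) ℂ) :
    eigenvalues U ∈ Set.Icc (0 : Fin N → ℝ) 1 :=
  ⟨fun i => eigenvalues_nonneg U i, fun i => eigenvalues_le_one U i⟩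

lemma integrable_eval_eigenvalues (μ : Measure (Matrix.unitaryGroup (Fin 2 × Fin N) ℂ))
    [IsFiniteMeasure μ] (f : MvPolynomial (Fin N) ℝ) :
    Integrable (fun U => MvPolynomial.eval (eigenvalues U) f) μ := by
  have hc := MvPolynomial.continuous_eval f
  obtain ⟨C, hC⟩ := (isCompact_Icc (a := (0 : Fin N → ℝ)) (b := 1)).exists_bound_of_continuousOn
    hc.continuousOn
  exact Integrable.of_bound (hc.measurable.comp measurable_eigenvalues).aestronglyMeasurable C
    (Filter.Eventually.of_forall fun U => hC _ (eigenvalues_mem_Icc U))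

/-- The expectation of a polynomial in the eigenvalues. -/
def haarFunctional (μ : Measure (Matrix.unitaryGroup (Fin 2 × Fin N) ℂ)) [IsFiniteMeasure μ] :
    MvPolynomial (Fin N) ℝ →ₗ[ℝ] ℝ where
  toFun f := ∫ U, MvPolynomial.eval (eigenvalues U) f ∂μ
  map_add' f g := by
    simp only [map_add]
    exact integral_add (integrable_eval_eigenvalues μ f) (integrable_eval_eigenvalues μ g)
  map_smul' c f := by
    simp only [MvPolynomial.smul_eval, RingHom.id_apply, smul_eq_mul]
    exact integral_const_mul _ _

lemma sdCoeff_add (f g : MvPolynomial (Fin N) ℝ) (k : ℕ) :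
    sdCoeff (f + g) k = sdCoeff f k + sdCoeff g k := by
  simp only [sdCoeff, map_add, add_mul, Finset.sum_add_distrib]
  ring

lemma sdCoeff_smul (c : ℝ) (f : MvPolynomial (Fin N) ℝ) (k : ℕ) :
    sdCoeff (c • f) k = c • sdCoeff f k := by
  simp only [sdCoeff, Derivation.map_smul, smul_mul_assoc, ← Finset.smul_sum, smul_add]

variable (μ : Measure (Matrix.unitaryGroup (Fin 2 × Fin N) ℂ)) [IsProbabilityMeasure μ]
  [μ.IsMulLeftInvariant]

/-- The Schwinger–Dyson equations for the Haar measure. -/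
theorem haarFunctional_sdCoeff {f : MvPolynomial (Fin N) ℝ} (hf : f ∈ coeffAlgebra (Fin N))
    (k : ℕ) : haarFunctional μ (sdCoeff f k) = 0 := by
  have hf' := coeffAlgebra_le_span hf
  clear hf
  induction hf' using Submodule.span_induction with
  | mem v hv =>
    -- A spanning element is a finite product of values p(yₗ), with the parameters read off from a
    -- list.
    obtain ⟨l, hl, rfl⟩ := Submonoid.exists_list_of_mem_closure hv
    choose y hy1 hy2 using fun i : Fin l.length => hl (l.get i) (l.get_mem i)
    have e : l.prod = ∏ i, (genPoly (Fin N)).eval (MvPolynomial.C (y i)) := by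
      conv_lhs => rw [← List.ofFn_get l, List.prod_ofFn]
      exact Finset.prod_congr rfl fun i _ => (hy2 i).symm
    rw [← coeff_sdPoly, e]
    exact apply_coeff_eq_zero (haarFunctional μ) _ (Set.Ioi_infinite (1 : ℝ))
      (fun z hz => integral_sdPoly_prod μ z hz y hy1) k
  | zero =>
    have := sdCoeff_smul 0 (0 : MvPolynomial (Fin N) ℝ) k
    rw [smul_zero, zero_smul] at this
    rw [this, map_zero]
  | add v w _ _ hv hw => rw [sdCoeff_add, map_add, hv, hw, add_zero]
  | smul r v _ hv => rw [sdCoeff_smul, map_smul, hv, smul_zero]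

/-- The difference of the two functionals satisfies the same linear equations and vanishes at 1, so
uniqueness applies. -/
theorem haarFunctional_eq {κ : ℝ} (hκ : κ * cubeIntegral N (vdm N ^ 2) = 1)
    {f : MvPolynomial (Fin N) ℝ} (hf : f.IsSymmetric) :
    haarFunctional μ f = κ * cubeIntegral N (f * vdm N ^ 2) := by
  let δ : MvPolynomial (Fin N) ℝ →ₗ[ℝ] ℝ :=
    haarFunctional μ - κ • (cubeIntegral N ∘ₗ LinearMap.mulRight ℝ (vdm N ^ 2))
  have hδ : ∀ f, δ f = haarFunctional μ f - κ * cubeIntegral N (f * vdm N ^ 2) := fun f => rfl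
  have h1 : haarFunctional μ 1 = 1 := by
    change ∫ U, MvPolynomial.eval (eigenvalues U) 1 ∂μ = 1
    simp
  have := eq_zero_of_sdCoeff δ (by rw [hδ, one_mul, hκ, h1, sub_self]) (fun f hf k => by
    rw [hδ, haarFunctional_sdCoeff μ hf, cubeIntegral_sdCoeff, mul_zero, sub_zero])
    (mem_coeffAlgebra_of_isSymmetric hf)
  rwa [hδ, sub_eq_zero] at this

end HaarFunctional

/-! ### Shifted Legendre polynomials and the kernel -/

section Legendre

/-- Integration of polynomials over the unit interval. -/
def unitIntegral : ℝ[X] →ₗ[ℝ] ℝ where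
  toFun p := ∫ x in (0 : ℝ)..1, p.eval x
  map_add' p q := by
    simp only [eval_add]
    exact intervalIntegral.integral_add (p.continuous.intervalIntegrable _ _)
      (q.continuous.intervalIntegrable _ _)
  map_smul' c p := by
    simp only [eval_smul, smul_eq_mul, RingHom.id_apply, intervalIntegral.integral_const_mul]

lemma unitIntegral_derivative (p : ℝ[X]) :
    unitIntegral (derivative p) = p.eval 1 - p.eval 0 :=
  intervalIntegral.integral_eq_sub_of_hasDerivAt (fun x _ => p.hasDerivAt x)
    ((derivative p).continuous.intervalIntegrable _ _)

/-- The shifted Legendre polynomial `Pₙ(2x - 1)`. -/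
def shiftedLegendre (n : ℕ) : ℝ[X] := (legendre n).comp (Polynomial.C 2 * X - 1)

lemma eval_shiftedLegendre (n : ℕ) (x : ℝ) :
    (shiftedLegendre n).eval x = (legendre n).eval (2 * x - 1) := by
  simp [shiftedLegendre]

lemma iterate_derivative_comp_affine (p : ℝ[X]) (n : ℕ) :
    derivative^[n] (p.comp (Polynomial.C 2 * X - 1)) =
      Polynomial.C (2 ^ n) * (derivative^[n] p).comp (Polynomial.C 2 * X - 1) := by
  induction n with
  | zero => simp
  | succ n ih =>
    rw [Function.iterate_succ_apply', ih, Function.iterate_succ_apply', derivative_C_mul,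
      derivative_comp, pow_succ, Polynomial.C_mul]
    simp only [derivative_sub, derivative_C_mul, derivative_X, derivative_one, mul_one, sub_zero]
    ring

lemma shiftedLegendre_eq (n : ℕ) : shiftedLegendre n =
    Polynomial.C ((n ! : ℝ)⁻¹) * derivative^[n] ((X ^ 2 - X) ^ n) := by
  have h1 : ((X ^ 2 - 1 : ℝ[X]) ^ n).comp (Polynomial.C 2 * X - 1) =
      Polynomial.C (4 ^ n) * (X ^ 2 - X) ^ n := by
    rw [pow_comp, sub_comp, pow_comp, X_comp, one_comp, Polynomial.C_pow, ← mul_pow]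
    congr 1
    have : (Polynomial.C 4 : ℝ[X]) = Polynomial.C 2 * Polynomial.C 2 := by
      rw [← Polynomial.C_mul]; norm_num
    have h2 : (Polynomial.C 2 : ℝ[X]) = 2 := rfl
    rw [this, h2]; ring
  have h2 := iterate_derivative_comp_affine ((X ^ 2 - 1) ^ n) n
  rw [h1, iterate_derivative_C_mul] at h2
  rw [shiftedLegendre, legendre, mul_comp, C_comp]
  have h3 : (Polynomial.C ((2 : ℝ) ^ n)) ≠ 0 := by simp
  refine mul_left_cancel₀ h3 ?_
  rw [mul_left_comm, ← h2, ← mul_assoc, ← mul_assoc, ← Polynomial.C_mul, ← Polynomial.C_mul]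
  congr 2
  have : (4 : ℝ) ^ n = 2 ^ n * 2 ^ n := by rw [← mul_pow]; norm_num
  rw [this]
  field_simp

lemma eval_iterate_derivative_eq_zero {n j : ℕ} (hj : j < n) {x : ℝ} (hx : x ^ 2 - x = 0) :
    (derivative^[j] ((X ^ 2 - X : ℝ[X]) ^ n)).eval x = 0 := by
  obtain ⟨r, hr⟩ := pow_sub_dvd_iterate_derivative_pow (X ^ 2 - X : ℝ[X]) n j
  rw [hr, eval_mul, eval_pow]
  simp [hx, Nat.sub_ne_zero_of_lt hj]

/-- Repeated integration by parts: boundary terms vanish because fewer than n derivatives leave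
zeros at 0 and 1, and each step lowers the degree of v until nothing is left. -/
lemma unitIntegral_iterate_derivative_mul {n j : ℕ} (hj : j ≤ n) {v : ℝ[X]} (hv : v.degree < j) :
    unitIntegral (derivative^[j] ((X ^ 2 - X) ^ n) * v) = 0 := by
  induction j generalizing v with
  | zero =>
    have : v = 0 := by
      rw [← degree_eq_bot]; exact Nat.WithBot.lt_zero_iff.1 (by simpa using hv)
    simp [this]
  | succ j ih =>
    have h := unitIntegral_derivative (derivative^[j] ((X ^ 2 - X) ^ n) * v)
    rw [eval_mul, eval_mul, eval_iterate_derivative_eq_zero (by omega) (by norm_num),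
      eval_iterate_derivative_eq_zero (by omega) (by norm_num), derivative_mul, map_add,
      ← Function.iterate_succ_apply' derivative] at h
    have hv' : unitIntegral (derivative^[j] ((X ^ 2 - X) ^ n) * derivative v) = 0 := by
      by_cases h0 : v = 0
      · simp [h0]
      · refine ih (by omega) ?_
        have h1 := degree_derivative_lt h0
        rw [degree_eq_natDegree h0] at h1 hv
        have : v.natDegree < j + 1 := by exact_mod_cast hv
        exact h1.trans_le (by exact_mod_cast (by omega : v.natDegree ≤ j))
    rw [hv'] at h
    simpa using h

lemma unitIntegral_shiftedLegendre_mul {n : ℕ} {v : ℝ[X]} (hv : v.degree < n) :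
    unitIntegral (shiftedLegendre n * v) = 0 := by
  rw [shiftedLegendre_eq, mul_assoc, ← smul_eq_C_mul, map_smul,
    unitIntegral_iterate_derivative_mul le_rfl hv, smul_zero]

lemma monic_X_sq_sub_X : (X ^ 2 - X : ℝ[X]).Monic := by
  have : (X ^ 2 - X : ℝ[X]) = X * (X - Polynomial.C 1) := by simp; ring
  rw [this]
  exact monic_X.mul (monic_X_sub_C 1)

lemma natDegree_X_sq_sub_X : (X ^ 2 - X : ℝ[X]).natDegree = 2 := by compute_degree!

lemma natDegree_shiftedLegendre (n : ℕ) : (shiftedLegendre n).natDegree = n := by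
  have hm : ((X ^ 2 - X : ℝ[X]) ^ n).natDegree = 2 * n := by
    rw [monic_X_sq_sub_X.natDegree_pow, natDegree_X_sq_sub_X]; ring
  refine natDegree_eq_of_le_of_coeff_ne_zero ?_ ?_
  · rw [shiftedLegendre_eq]
    refine (natDegree_C_mul_le _ _).trans ((natDegree_iterate_derivative _ _).trans ?_)
    rw [hm]; omega
  · rw [shiftedLegendre_eq, coeff_C_mul, coeff_iterate_derivative]
    have h1 : ((X ^ 2 - X : ℝ[X]) ^ n).coeff (n + n) = 1 := by
      have := monic_X_sq_sub_X.pow n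
      rw [Monic, leadingCoeff, hm] at this
      rw [← two_mul]; exact this
    rw [h1]
    have : (n + n).descFactorial n ≠ 0 := by
      rw [Ne, Nat.descFactorial_eq_zero_iff_lt]; omega
    simp only [nsmul_eq_mul, mul_one]
    have h2 : (n ! : ℝ) ≠ 0 := by exact_mod_cast Nat.factorial_ne_zero n
    exact mul_ne_zero (inv_ne_zero h2) (by exact_mod_cast this)

lemma shiftedLegendre_ne_zero (n : ℕ) : shiftedLegendre n ≠ 0 := by
  rcases n with _ | n
  · rw [shiftedLegendre_eq]; simp
  · intro h
    have := natDegree_shiftedLegendre (n + 1)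
    rw [h] at this; simp at this

lemma degree_shiftedLegendre (n : ℕ) : (shiftedLegendre n).degree = n := by
  rw [degree_eq_natDegree (shiftedLegendre_ne_zero n), natDegree_shiftedLegendre]

/-- Expanded at 1, (X² - X)^n becomes X^n (X + 1)^n, whose n-th Taylor coefficient is 1; the
factorial from differentiating cancels the one in Rodrigues' formula. -/
lemma eval_one_shiftedLegendre (n : ℕ) : (shiftedLegendre n).eval 1 = 1 := by
  have h : ((taylor 1 ((X ^ 2 - X : ℝ[X]) ^ n))).coeff n = 1 := by
    have : taylor 1 ((X ^ 2 - X : ℝ[X]) ^ n) = X ^ n * (X + 1) ^ n := by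
      rw [taylor_pow, ← mul_pow]
      congr 1
      simp [taylor_apply]
      ring
    rw [this, coeff_X_pow_mul']
    simp [coeff_zero_eq_eval_zero]
  rw [taylor_coeff] at h
  have h2 := congrArg (fun f => f ((X ^ 2 - X : ℝ[X]) ^ n)) (factorial_smul_hasseDeriv (R := ℝ) n)
  rw [LinearMap.smul_apply] at h2
  rw [shiftedLegendre_eq, eval_mul, eval_C, ← h2, eval_smul, h]
  have h2 : (n ! : ℝ) ≠ 0 := by exact_mod_cast Nat.factorial_ne_zero n
  simp [h2]

/-- Integrating (x p²)' gives p(1)² = 1. Since x p' - n p has degree below n, it is orthogonal to p,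
so the integral of p² + 2x p p' is (2n + 1) times that of p². -/
lemma unitIntegral_shiftedLegendre_sq (n : ℕ) :
    unitIntegral (shiftedLegendre n * shiftedLegendre n) = (2 * (n : ℝ) + 1)⁻¹ := by
  set p := shiftedLegendre n with hp
  have h := unitIntegral_derivative (X * (p * p))
  have e : derivative (X * (p * p)) = (2 * (n : ℝ) + 1) • (p * p) +
      (2 : ℝ) • (p * (X * derivative p - Polynomial.C (n : ℝ) * p)) := by
    simp only [derivative_mul, derivative_X, smul_eq_C_mul, map_add, map_mul, map_one]
    have : (Polynomial.C 2 : ℝ[X]) = 2 := rfl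
    rw [this]
    ring
  have hdeg : (X * derivative p - Polynomial.C (n : ℝ) * p).degree < (n : WithBot ℕ) := by
    rw [degree_lt_iff_coeff_zero]
    intro k hk
    rw [coeff_sub, coeff_C_mul]
    rcases k with _ | k
    · obtain rfl : n = 0 := by omega
      simp
    · rw [coeff_X_mul, coeff_derivative]
      rcases eq_or_lt_of_le hk with h | h
      · rw [← h]; rw [h]; push_cast; ring
      · rw [coeff_eq_zero_of_natDegree_lt (by rw [hp, natDegree_shiftedLegendre]; exact h)]
        simp
  rw [e, map_add, map_smul, map_smul, unitIntegral_shiftedLegendre_mul hdeg, smul_zero, add_zero,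
    smul_eq_mul] at h
  simp only [eval_mul, eval_X, hp, eval_one_shiftedLegendre, zero_mul] at h
  exact eq_inv_of_mul_eq_one_right (by rw [hp]; linarith)

lemma weight_two (N : ℕ) (x : ℝ) : weight N 2 x = 1 := by simp [weight]

lemma weightedInner_eq (N : ℕ) (f g : ℝ[X]) :
    weightedInner (weight N 2) f g = unitIntegral (f * g) := by
  simp [weightedInner, weight_two, unitIntegral]

/-- The monic multiple of the shifted Legendre polynomial. -/
def monicLegendre (n : ℕ) : ℝ[X] :=
  Polynomial.C (shiftedLegendre n).leadingCoeff⁻¹ * shiftedLegendre n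

lemma monic_monicLegendre (n : ℕ) : (monicLegendre n).Monic := by
  rw [monicLegendre, mul_comm]
  exact monic_mul_leadingCoeff_inv (shiftedLegendre_ne_zero n)

lemma natDegree_monicLegendre (n : ℕ) : (monicLegendre n).natDegree = n := by
  rw [monicLegendre, natDegree_C_mul (inv_ne_zero (leadingCoeff_ne_zero.2
    (shiftedLegendre_ne_zero n))), natDegree_shiftedLegendre]

lemma unitIntegral_monicLegendre_mul {n : ℕ} {v : ℝ[X]} (hv : v.degree < n) :
    unitIntegral (monicLegendre n * v) = 0 := by
  rw [monicLegendre, mul_assoc, ← smul_eq_C_mul, map_smul, unitIntegral_shiftedLegendre_mul hv,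
    smul_zero]

lemma degree_monicLegendre (n : ℕ) : (monicLegendre n).degree = n := by
  rw [degree_eq_natDegree (monic_monicLegendre n).ne_zero, natDegree_monicLegendre]

lemma isMonicOrthogonal_monicLegendre (N : ℕ) :
    IsMonicOrthogonal (weight N 2) fun i : Fin N => monicLegendre i where
  monic i := monic_monicLegendre i
  natDegree_eq i := natDegree_monicLegendre i
  orthogonal i j hij := by
    rw [weightedInner_eq]
    rcases lt_or_gt_of_ne hij with h | h
    · rw [mul_comm]
      exact unitIntegral_monicLegendre_mul (by rw [degree_monicLegendre]; exact_mod_cast h)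
    · exact unitIntegral_monicLegendre_mul (by rw [degree_monicLegendre]; exact_mod_cast h)

lemma unitIntegral_monicLegendre_sq (n : ℕ) :
    unitIntegral (monicLegendre n * monicLegendre n) =
      (shiftedLegendre n).leadingCoeff⁻¹ ^ 2 * (2 * (n : ℝ) + 1)⁻¹ := by
  have e : monicLegendre n * monicLegendre n =
      ((shiftedLegendre n).leadingCoeff⁻¹ ^ 2) • (shiftedLegendre n * shiftedLegendre n) := by
    rw [monicLegendre, smul_eq_C_mul, Polynomial.C_pow]
    ring
  rw [e, map_smul, unitIntegral_shiftedLegendre_sq, smul_eq_mul]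

/-- Uniqueness in Gram–Schmidt: each C i is orthogonal to all polynomials of smaller degree, because
these are combinations of the earlier members of the family. -/
lemma eq_monicLegendre {N : ℕ} {C : Fin N → ℝ[X]} (hC : IsMonicOrthogonal (weight N 2) C)
    (i : Fin N) : C i = monicLegendre i := by
  have horth : ∀ d : ℕ, ∀ v : ℝ[X], v.natDegree ≤ d → d < i → unitIntegral (C i * v) = 0 := by
    intro d
    induction d using Nat.strong_induction_on with
    | _ d ih =>
    intro v hv hd
    let j : Fin N := ⟨d, hd.trans i.2⟩
    have hCj : (C j).natDegree = d := hC.natDegree_eq j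
    have h1 : unitIntegral (C i * C j) = 0 := by
      rw [← weightedInner_eq N]
      exact hC.orthogonal i j (by intro h; rw [h] at hd; exact lt_irrefl _ hd)
    have e : C i * v = v.coeff d • (C i * C j) + C i * (v - Polynomial.C (v.coeff d) * C j) := by
      rw [smul_eq_C_mul]; ring
    rw [e, map_add, map_smul, h1, smul_zero, zero_add]
    have hcoef : (C j).coeff d = 1 := by
      have := hC.monic j
      rwa [Monic, leadingCoeff, hCj] at this
    have hdeg : (v - Polynomial.C (v.coeff d) * C j).degree < d := by
      rw [degree_lt_iff_coeff_zero]
      intro k hk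
      rw [coeff_sub, coeff_C_mul]
      rcases eq_or_lt_of_le hk with h | h
      · rw [← h, hcoef]; ring
      · rw [coeff_eq_zero_of_natDegree_lt (hv.trans_lt h),
          coeff_eq_zero_of_natDegree_lt (p := C j) (by rw [hCj]; exact h)]; ring
    by_cases h0 : v - Polynomial.C (v.coeff d) * C j = 0
    · rw [h0]; simp
    · have := (natDegree_lt_iff_degree_lt h0).2 hdeg
      exact ih _ this _ le_rfl (this.trans hd)
  by_contra hne
  -- v has degree k < i and is orthogonal to the monic Legendre polynomial of degree k. That pairing
  -- is the leading coefficient of v times a nonzero norm, so v = 0.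
  set v := C i - monicLegendre i with hv
  have hv0 : v ≠ 0 := sub_ne_zero.2 hne
  have hlt : v.degree < (i : ℕ) := by
    have := degree_sub_lt_left (p := C i) (q := monicLegendre i) ?_ (hC.monic i).ne_zero ?_
    · rwa [degree_eq_natDegree (hC.monic i).ne_zero, hC.natDegree_eq] at this
    · rw [degree_eq_natDegree (hC.monic i).ne_zero, hC.natDegree_eq, degree_monicLegendre]
    · rw [(hC.monic i).leadingCoeff, (monic_monicLegendre i).leadingCoeff]
  set k := v.natDegree with hk
  have hki : k < i := (natDegree_lt_iff_degree_lt hv0).2 hlt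
  have h1 : unitIntegral (monicLegendre k * v) = 0 := by
    have a := horth k (monicLegendre k) (natDegree_monicLegendre k).le hki
    have b := unitIntegral_monicLegendre_mul (n := i) (v := monicLegendre k)
      (by rw [degree_monicLegendre]; exact_mod_cast hki)
    rw [hv, mul_comm, sub_mul, map_sub, a, b, sub_zero]
  have hdeg : (v - Polynomial.C v.leadingCoeff * monicLegendre k).degree < k := by
    rw [degree_lt_iff_coeff_zero]
    intro l hl
    rw [coeff_sub, coeff_C_mul]
    rcases eq_or_lt_of_le hl with h | h
    · have : (monicLegendre k).coeff k = 1 := by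
        have := monic_monicLegendre k
        rwa [Monic, leadingCoeff, natDegree_monicLegendre] at this
      rw [← h, this, leadingCoeff]; ring
    · rw [coeff_eq_zero_of_natDegree_lt h,
        coeff_eq_zero_of_natDegree_lt (p := monicLegendre k) (by rw [natDegree_monicLegendre]; exact h)]; ring
  have h2 := unitIntegral_monicLegendre_mul hdeg
  have e : monicLegendre k * (v - Polynomial.C v.leadingCoeff * monicLegendre k) =
      monicLegendre k * v - v.leadingCoeff • (monicLegendre k * monicLegendre k) := by
    rw [smul_eq_C_mul]; ring
  rw [e, map_sub, h1, map_smul, zero_sub, neg_eq_zero, smul_eq_mul,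
    unitIntegral_monicLegendre_sq] at h2
  have hl := inv_ne_zero (leadingCoeff_ne_zero.2 (shiftedLegendre_ne_zero k))
  have : (2 * (k : ℝ) + 1)⁻¹ ≠ 0 := by positivity
  exact mul_ne_zero (leadingCoeff_ne_zero.2 hv0) (mul_ne_zero (pow_ne_zero 2 hl) this) h2

lemma kernel_monicLegendre (N : ℕ) (x y : ℝ) :
    kernel (weight N 2) (fun i : Fin N => monicLegendre i) x y = legendreKernel N x y := by
  rw [kernel, weight_two, one_mul, legendreKernel, Finset.sum_range]
  refine Finset.sum_congr rfl fun i _ => ?_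
  rw [weightedInner_eq, unitIntegral_monicLegendre_sq, monicLegendre, ← eval_shiftedLegendre,
    ← eval_shiftedLegendre]
  have hl := leadingCoeff_ne_zero.2 (shiftedLegendre_ne_zero i)
  simp only [eval_mul, eval_C]
  field_simp

lemma kernel_eq {N : ℕ} {C : Fin N → ℝ[X]} (hC : IsMonicOrthogonal (weight N 2) C) (x y : ℝ) :
    kernel (weight N 2) C x y = legendreKernel N x y := by
  rw [← kernel_monicLegendre, show C = fun i : Fin N => monicLegendre i from
    funext (eq_monicLegendre hC)]

end Legendre

/-! ### Projection kernels and marginals of the determinantal density -/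

section Determinantal

/-- The determinant of a positive semidefinite matrix bordered by one row and one column. -/
lemma det_fromBlocks_border {n : Type*} [Fintype n] [DecidableEq n] {M : Matrix n n ℝ}
    (hM : M.PosSemidef) (B : Matrix n (Fin 1) ℝ) (C : Matrix (Fin 1) n ℝ)
    (D : Matrix (Fin 1) (Fin 1) ℝ) :
    (Matrix.fromBlocks M B C D).det =
      D 0 0 * M.det - ∑ i, ∑ j, C 0 i * M.adjugate i j * B j 0 := by
  -- M may be singular. For t > 0 the matrix M + t is positive definite and the Schur complement
  -- applies; both sides are continuous as t tends to 0.
  have hcont : Continuous fun t : ℝ => M + t • (1 : Matrix n n ℝ) := by fun_prop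
  have h1 : Continuous fun t : ℝ => (Matrix.fromBlocks (M + t • (1 : Matrix n n ℝ)) B C D).det :=
    (hcont.matrix_fromBlocks continuous_const continuous_const continuous_const).matrix_det
  have h2 : Continuous fun t : ℝ => D 0 0 * (M + t • (1 : Matrix n n ℝ)).det -
      ∑ i, ∑ j, C 0 i * (M + t • (1 : Matrix n n ℝ)).adjugate i j * B j 0 := by
    refine (continuous_const.mul hcont.matrix_det).sub ?_
    refine continuous_finsetSum _ fun i _ => continuous_finsetSum _ fun j _ => ?_
    exact (continuous_const.mul (hcont.matrix_adjugate.matrix_elem i j)).mul continuous_const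
  have h3 : ∀ t ∈ Set.Ioi (0 : ℝ),
      (Matrix.fromBlocks (M + t • (1 : Matrix n n ℝ)) B C D).det =
      D 0 0 * (M + t • (1 : Matrix n n ℝ)).det -
      ∑ i, ∑ j, C 0 i * (M + t • (1 : Matrix n n ℝ)).adjugate i j * B j 0 := by
    intro t ht
    have hpd : (M + t • (1 : Matrix n n ℝ)).PosDef :=
      Matrix.PosDef.posSemidef_add hM (Matrix.PosDef.one.smul ht)
    set A := M + t • (1 : Matrix n n ℝ)
    have hdet : A.det ≠ 0 := hpd.det_pos.ne'
    let : Invertible A := Matrix.invertibleOfIsUnitDet A (isUnit_iff_ne_zero.2 hdet)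
    rw [Matrix.det_fromBlocks₁₁, Matrix.det_fin_one, Matrix.sub_apply, mul_sub, mul_comm A.det]
    congr 1
    rw [Matrix.invOf_eq_nonsing_inv, Matrix.inv_def, Matrix.mul_smul, Matrix.smul_mul,
      Matrix.smul_apply, smul_eq_mul, ← mul_assoc, Ring.inverse_eq_inv, mul_inv_cancel₀ hdet,
      one_mul, Matrix.mul_apply, Finset.sum_comm]
    refine Finset.sum_congr rfl fun j _ => ?_
    rw [Matrix.mul_apply, Finset.sum_mul]
  have h4 := (Set.EqOn.closure h3 h1 h2) (x := 0) (by rw [closure_Ioi]; exact Set.self_mem_Ici)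
  simpa using h4

lemma legendreKernel_eq_sum (N : ℕ) (x y : ℝ) : legendreKernel N x y =
    ∑ i : Fin N, (2 * (i : ℝ) + 1) * (shiftedLegendre i).eval x * (shiftedLegendre i).eval y := by
  simp only [legendreKernel, eval_shiftedLegendre]
  exact Finset.sum_range fun i : ℕ =>
    (2 * (i : ℝ) + 1) * (legendre i).eval (2 * x - 1) * (legendre i).eval (2 * y - 1)

lemma continuous_legendreKernel (N : ℕ) :
    Continuous fun p : ℝ × ℝ => legendreKernel N p.1 p.2 := by
  simp only [legendreKernel_eq_sum]
  refine continuous_finsetSum _ fun i _ => ?_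
  exact (continuous_const.mul ((shiftedLegendre i).continuous.comp continuous_fst)).mul
    ((shiftedLegendre i).continuous.comp continuous_snd)

/-- The matrix `[K(xⱼ, xₖ)]` of the Legendre kernel. -/
def kernelMatrix (N : ℕ) {ℓ : ℕ} (x : Fin ℓ → ℝ) : Matrix (Fin ℓ) (Fin ℓ) ℝ :=
  Matrix.of fun j k => legendreKernel N (x j) (x k)

/-- A Gram matrix: row j holds the values at xⱼ of the orthonormal polynomials √(2i+1) Pᵢ(2x-1). -/
lemma posSemidef_kernelMatrix (N : ℕ) {ℓ : ℕ} (x : Fin ℓ → ℝ) :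
    (kernelMatrix N x).PosSemidef := by
  have e : kernelMatrix N x = (Matrix.of fun (j : Fin ℓ) (i : Fin N) =>
      √(2 * (i : ℝ) + 1) * (shiftedLegendre i).eval (x j)) *
      (Matrix.of fun (j : Fin ℓ) (i : Fin N) =>
        √(2 * (i : ℝ) + 1) * (shiftedLegendre i).eval (x j)).conjTranspose := by
    ext j k
    simp only [kernelMatrix, Matrix.of_apply, legendreKernel_eq_sum, Matrix.mul_apply,
      Matrix.conjTranspose_apply, star_trivial]
    refine Finset.sum_congr rfl fun i _ => ?_
    have : √(2 * (i : ℝ) + 1) * √(2 * (i : ℝ) + 1) = 2 * (i : ℝ) + 1 :=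
      Real.mul_self_sqrt (by positivity)
    linear_combination -(shiftedLegendre i).eval (x j) * (shiftedLegendre i).eval (x k) * this
  rw [e]
  exact Matrix.posSemidef_self_mul_conjTranspose _

lemma determinantalDensity_eq (N : ℕ) {ℓ : ℕ} (x : Fin ℓ → ℝ) :
    determinantalDensity N (legendreKernel N) x =
      (((N - ℓ)! : ℕ) : ℝ) / (N ! : ℝ) * (kernelMatrix N x).det := rfl

lemma determinantalDensity_nonneg (N : ℕ) {ℓ : ℕ} (x : Fin ℓ → ℝ) :
    0 ≤ determinantalDensity N (legendreKernel N) x :=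
  mul_nonneg (by positivity) (posSemidef_kernelMatrix N x).det_nonneg

lemma continuous_determinantalDensity (N ℓ : ℕ) :
    Continuous fun x : Fin ℓ → ℝ => determinantalDensity N (legendreKernel N) x := by
  refine continuous_const.mul (Continuous.matrix_det ?_)
  refine continuous_matrix fun j k => ?_
  exact (continuous_legendreKernel N).comp
    (g := fun p : ℝ × ℝ => legendreKernel N p.1 p.2) (f := fun x : Fin ℓ → ℝ => (x j, x k))
    ((continuous_apply j).prodMk (continuous_apply k))

lemma integral_shiftedLegendre (i j : ℕ) :
    ∫ y in (0 : ℝ)..1, (shiftedLegendre i).eval y * (shiftedLegendre j).eval y =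
      if i = j then (2 * (i : ℝ) + 1)⁻¹ else 0 := by
  have h : ∫ y in (0 : ℝ)..1, (shiftedLegendre i).eval y * (shiftedLegendre j).eval y =
      unitIntegral (shiftedLegendre i * shiftedLegendre j) := by
    simp [unitIntegral]
  rw [h]
  split_ifs with hij
  · rw [hij, unitIntegral_shiftedLegendre_sq]
  · rcases lt_or_gt_of_ne hij with h | h
    · rw [mul_comm]
      exact unitIntegral_shiftedLegendre_mul (by rw [degree_shiftedLegendre]; exact_mod_cast h)
    · exact unitIntegral_shiftedLegendre_mul (by rw [degree_shiftedLegendre]; exact_mod_cast h)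

lemma integral_legendreKernel_diag (N : ℕ) :
    ∫ y in (0 : ℝ)..1, legendreKernel N y y = N := by
  simp only [legendreKernel_eq_sum]
  rw [intervalIntegral.integral_finsetSum]
  · simp only [mul_assoc, intervalIntegral.integral_const_mul, integral_shiftedLegendre, if_true]
    rw [Finset.sum_congr rfl fun i _ => mul_inv_cancel₀ (by positivity)]
    simp
  · intro i _
    exact Continuous.intervalIntegrable (by fun_prop) _ _

/-- The reproducing property: K is the orthogonal projection onto polynomials of degree below N. -/
lemma integral_legendreKernel_mul (N : ℕ) (x z : ℝ) :
    ∫ y in (0 : ℝ)..1, legendreKernel N x y * legendreKernel N y z = legendreKernel N x z := by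
  simp only [legendreKernel_eq_sum, Finset.sum_mul_sum]
  rw [intervalIntegral.integral_finsetSum]
  · refine Finset.sum_congr rfl fun i _ => ?_
    rw [intervalIntegral.integral_finsetSum]
    · have : ∀ j : Fin N, ∫ y in (0 : ℝ)..1, (2 * (i : ℝ) + 1) * (shiftedLegendre i).eval x *
          (shiftedLegendre i).eval y *
          ((2 * (j : ℝ) + 1) * (shiftedLegendre j).eval y * (shiftedLegendre j).eval z) =
          if i = j then (2 * (i : ℝ) + 1) * (shiftedLegendre i).eval x *
            (shiftedLegendre i).eval z else 0 := by
        intro j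
        have e : ∀ y : ℝ, (2 * (i : ℝ) + 1) * (shiftedLegendre i).eval x *
          (shiftedLegendre i).eval y *
          ((2 * (j : ℝ) + 1) * (shiftedLegendre j).eval y * (shiftedLegendre j).eval z) =
          ((2 * (i : ℝ) + 1) * (shiftedLegendre i).eval x * (2 * (j : ℝ) + 1) *
            (shiftedLegendre j).eval z) *
            ((shiftedLegendre i).eval y * (shiftedLegendre j).eval y) := fun y => by ring
        simp only [e, intervalIntegral.integral_const_mul, integral_shiftedLegendre, Fin.val_inj]
        split_ifs with hij
        · subst hij
          field_simp
        · simp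
      simp only [this, Finset.sum_ite_eq, Finset.mem_univ, if_true]
    · intro j _
      exact Continuous.intervalIntegrable (by fun_prop) _ _
  · intro i _
    exact Continuous.intervalIntegrable (by fun_prop) _ _

lemma det_kernelMatrix_snoc (N : ℕ) {ℓ : ℕ} (x : Fin ℓ → ℝ) (y : ℝ) :
    (kernelMatrix N (Fin.snoc x y : Fin (ℓ + 1) → ℝ)).det =
      legendreKernel N y y * (kernelMatrix N x).det -
        ∑ i, ∑ j, (kernelMatrix N x).adjugate i j *
          (legendreKernel N (x j) y * legendreKernel N y (x i)) := by
  rw [← Matrix.det_submatrix_equiv_self (finSumFinEquiv (m := ℓ) (n := 1))]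
  have e : (kernelMatrix N (Fin.snoc x y : Fin (ℓ + 1) → ℝ)).submatrix
      (finSumFinEquiv (m := ℓ) (n := 1)) (finSumFinEquiv (m := ℓ) (n := 1)) =
      Matrix.fromBlocks (kernelMatrix N x) (Matrix.of fun j _ => legendreKernel N (x j) y)
        (Matrix.of fun _ i => legendreKernel N y (x i))
        (Matrix.of fun _ _ => legendreKernel N y y) := by
    have hl : ∀ i : Fin ℓ, (Fin.snoc x y : Fin (ℓ + 1) → ℝ) (Fin.castAdd 1 i) = x i :=
      fun i => Fin.snoc_castSucc (α := fun _ => ℝ) y x i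
    have hr : ∀ i : Fin 1, (Fin.snoc x y : Fin (ℓ + 1) → ℝ) (Fin.natAdd ℓ i) = y := by
      intro i
      have : Fin.natAdd ℓ i = Fin.last ℓ := by ext; simp
      rw [this]
      exact Fin.snoc_last (α := fun _ => ℝ) y x
    ext (i | i) (j | j) <;> simp [kernelMatrix, hl, hr]
  rw [e, det_fromBlocks_border (posSemidef_kernelMatrix N x)]
  simp only [Matrix.of_apply]
  congr 1
  exact Finset.sum_congr rfl fun i _ => Finset.sum_congr rfl fun j _ => by ring

/-- The diagonal term integrates to N, the trace of the projection. By the reproducing property the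
border terms become the trace of adj(K)·K, which is ℓ copies of the determinant. -/
lemma integral_det_kernelMatrix_snoc (N : ℕ) {ℓ : ℕ} (x : Fin ℓ → ℝ) :
    ∫ y in (0 : ℝ)..1, (kernelMatrix N (Fin.snoc x y : Fin (ℓ + 1) → ℝ)).det =
      ((N : ℝ) - ℓ) * (kernelMatrix N x).det := by
  have c1 : Continuous fun y => legendreKernel N y y :=
    (continuous_legendreKernel N).comp (continuous_id.prodMk continuous_id)
  have c2 : ∀ z, Continuous fun y => legendreKernel N z y := fun z =>
    (continuous_legendreKernel N).comp (continuous_const.prodMk continuous_id)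
  have c3 : ∀ z, Continuous fun y => legendreKernel N y z := fun z =>
    (continuous_legendreKernel N).comp (continuous_id.prodMk continuous_const)
  have c4 : ∀ i j, Continuous fun y => (kernelMatrix N x).adjugate i j *
      (legendreKernel N (x j) y * legendreKernel N y (x i)) := fun i j =>
    continuous_const.mul ((c2 _).mul (c3 _))
  simp only [det_kernelMatrix_snoc]
  have c5 : Continuous fun y => legendreKernel N y y * (kernelMatrix N x).det :=
    c1.mul continuous_const
  rw [intervalIntegral.integral_sub (c5.intervalIntegrable _ _)
    ((continuous_finsetSum _ fun i _ => continuous_finsetSum _ fun j _ =>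
      c4 i j).intervalIntegrable _ _), intervalIntegral.integral_mul_const,
    integral_legendreKernel_diag, sub_mul]
  congr 1
  rw [intervalIntegral.integral_finsetSum fun i _ => (continuous_finsetSum _ fun j _ =>
      c4 i j).intervalIntegrable _ _]
  have h : ∀ i, ∫ y in (0 : ℝ)..1, ∑ j, (kernelMatrix N x).adjugate i j *
      (legendreKernel N (x j) y * legendreKernel N y (x i)) = (kernelMatrix N x).det := by
    intro i
    rw [intervalIntegral.integral_finsetSum fun j _ => (c4 i j).intervalIntegrable _ _]
    simp only [intervalIntegral.integral_const_mul, integral_legendreKernel_mul]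
    have := congrFun (congrFun (Matrix.adjugate_mul (kernelMatrix N x)) i) i
    rw [Matrix.mul_apply] at this
    simpa [kernelMatrix] using this
  simp [h]

/-- The factor N - ℓ from integration turns (N - ℓ - 1)! into (N - ℓ)!. -/
lemma integral_determinantalDensity_snoc {N ℓ : ℕ} (hℓ : ℓ + 1 ≤ N) (x : Fin ℓ → ℝ) :
    ∫ y in (0 : ℝ)..1, determinantalDensity N (legendreKernel N)
      (Fin.snoc x y : Fin (ℓ + 1) → ℝ) = determinantalDensity N (legendreKernel N) x := by
  simp only [determinantalDensity_eq, intervalIntegral.integral_const_mul,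
    integral_det_kernelMatrix_snoc]
  obtain ⟨k, rfl⟩ := Nat.exists_eq_add_of_le hℓ
  rw [show ℓ + 1 + k - (ℓ + 1) = k by omega, show ℓ + 1 + k - ℓ = k + 1 by omega,
    Nat.factorial_succ]
  push_cast
  ring

/-- The measure on `[0,1]^ℓ` with the determinantal density. -/
def determinantalMeasure (N ℓ : ℕ) : Measure (Fin ℓ → ℝ) :=
  (volume.restrict (Set.Icc (0 : Fin ℓ → ℝ) 1)).withDensity fun x =>
    ENNReal.ofReal (determinantalDensity N (legendreKernel N) x)

lemma measurable_ofReal_determinantalDensity (N ℓ : ℕ) : Measurable fun x : Fin ℓ → ℝ =>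
    ENNReal.ofReal (determinantalDensity N (legendreKernel N) x) :=
  (continuous_determinantalDensity N ℓ).measurable.ennreal_ofReal

lemma map_init_determinantalMeasure {N ℓ : ℕ} (hℓ : ℓ + 1 ≤ N) :
    (determinantalMeasure N (ℓ + 1)).map (fun x i => x (Fin.castSucc i)) =
      determinantalMeasure N ℓ := by
  have hmeas : Measurable fun (x : Fin (ℓ + 1) → ℝ) (i : Fin ℓ) => x (Fin.castSucc i) := by
    fun_prop
  ext s hs
  have hI : MeasurableSet (Set.Icc (0 : Fin ℓ → ℝ) 1) := measurableSet_Icc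
  rw [Measure.map_apply hmeas hs, determinantalMeasure, determinantalMeasure,
    withDensity_apply _ (hmeas hs), withDensity_apply _ hs,
    Measure.restrict_restrict (hmeas hs), Measure.restrict_restrict hs,
    ← lintegral_indicator ((hmeas hs).inter measurableSet_Icc),
    ← lintegral_indicator (hs.inter hI)]
  have hmp := (volume_preserving_piFinSuccAbove (fun _ : Fin (ℓ + 1) => ℝ) (Fin.last ℓ)).symm
  rw [← hmp.lintegral_comp ((measurable_ofReal_determinantalDensity N (ℓ + 1)).indicator
    ((hmeas hs).inter measurableSet_Icc))]
  have hsymm : ∀ p : ℝ × (Fin ℓ → ℝ),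
      (MeasurableEquiv.piFinSuccAbove (fun _ : Fin (ℓ + 1) => ℝ) (Fin.last ℓ)).symm p =
      (Fin.snoc p.2 p.1 : Fin (ℓ + 1) → ℝ) := fun p => by
    simp [MeasurableEquiv.piFinSuccAbove, Fin.snocEquiv]
  have hF := ((measurable_ofReal_determinantalDensity N (ℓ + 1)).indicator
    ((hmeas hs).inter (measurableSet_Icc (a := (0 : Fin (ℓ + 1) → ℝ)) (b := 1)))).comp hmp.measurable
  rw [Function.comp_def] at hF
  simp only [hsymm] at hF ⊢
  rw [Measure.volume_eq_prod, lintegral_prod_symm _ hF.aemeasurable]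
  refine lintegral_congr fun z => ?_
  have hmem : ∀ y : ℝ, (Fin.snoc z y : Fin (ℓ + 1) → ℝ) ∈
      ((fun (x : Fin (ℓ + 1) → ℝ) (i : Fin ℓ) => x (Fin.castSucc i)) ⁻¹' s ∩ Set.Icc 0 1) ↔
      z ∈ s ∩ Set.Icc 0 1 ∧ y ∈ Set.Icc (0 : ℝ) 1 := by
    intro y
    simp only [Set.mem_inter_iff, Set.mem_preimage, Fin.snoc_castSucc, Set.mem_Icc, Pi.le_def,
      Fin.forall_fin_succ', Fin.snoc_last, Pi.zero_apply, Pi.one_apply]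
    tauto
  by_cases hz : z ∈ s ∩ Set.Icc 0 1
  · rw [Set.indicator_of_mem hz]
    have e : ∀ y : ℝ, ((fun (x : Fin (ℓ + 1) → ℝ) (i : Fin ℓ) => x (Fin.castSucc i)) ⁻¹' s ∩
        Set.Icc 0 1).indicator (fun x => ENNReal.ofReal
          (determinantalDensity N (legendreKernel N) x)) (Fin.snoc z y : Fin (ℓ + 1) → ℝ) =
        (Set.Icc (0 : ℝ) 1).indicator (fun y => ENNReal.ofReal
          (determinantalDensity N (legendreKernel N) (Fin.snoc z y : Fin (ℓ + 1) → ℝ))) y := by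
      intro y
      by_cases hy : y ∈ Set.Icc (0 : ℝ) 1
      · rw [Set.indicator_of_mem ((hmem y).2 ⟨hz, hy⟩), Set.indicator_of_mem hy]
      · rw [Set.indicator_of_notMem fun h => hy ((hmem y).1 h).2, Set.indicator_of_notMem hy]
    have hc : Continuous fun y : ℝ =>
        determinantalDensity N (legendreKernel N) (Fin.snoc z y : Fin (ℓ + 1) → ℝ) :=
      (continuous_determinantalDensity N (ℓ + 1)).comp
        (f := fun y => (Fin.snoc z y : Fin (ℓ + 1) → ℝ))
        (continuous_pi fun i => Fin.lastCases (by simpa using continuous_id')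
          (fun i => by simpa using continuous_const) i)
    simp only [e]
    rw [lintegral_indicator measurableSet_Icc, ← ofReal_integral_eq_lintegral_ofReal
      hc.continuousOn.integrableOn_Icc (ae_of_all _ fun y => determinantalDensity_nonneg N _),
      integral_Icc_eq_integral_Ioc, ← intervalIntegral.integral_of_le zero_le_one,
      integral_determinantalDensity_snoc hℓ]
  · rw [Set.indicator_of_notMem hz]
    simp only [Set.indicator_of_notMem fun h => hz ((hmem _).1 h).1, lintegral_zero]

lemma map_castLE_determinantalMeasure {N ℓ : ℕ} (hℓ : ℓ ≤ N) :
    (determinantalMeasure N N).map (fun x i => x (Fin.castLE hℓ i)) =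
      determinantalMeasure N ℓ := by
  induction hℓ using Nat.decreasingInduction with
  | self => exact Measure.map_id
  | of_succ ℓ hℓ ih =>
    rw [← map_init_determinantalMeasure hℓ, ← ih, Measure.map_map (by fun_prop) (by fun_prop)]
    rfl

/-- The total mass is that of the marginal on zero variables, a point with density N!/N! times an
empty determinant. No Selberg-type integral is needed. -/
lemma isProbabilityMeasure_determinantalMeasure (N : ℕ) :
    IsProbabilityMeasure (determinantalMeasure N N) := by
  constructor
  have h := congrArg (fun ν => ν Set.univ) (map_castLE_determinantalMeasure (Nat.zero_le N))
  rw [Measure.map_apply (by fun_prop) MeasurableSet.univ, Set.preimage_univ] at h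
  rw [h, determinantalMeasure, withDensity_apply _ MeasurableSet.univ, Measure.restrict_univ]
  have : (N ! : ℝ) ≠ 0 := by exact_mod_cast Nat.factorial_ne_zero N
  have hu : Set.Icc (0 : Fin 0 → ℝ) 1 = Set.univ :=
    Set.eq_univ_of_forall fun x => ⟨fun i => i.elim0, fun i => i.elim0⟩
  rw [hu]
  simp [determinantalDensity, this, volume_pi]

end Determinantal

/-! ### Identification of the eigenvalue law -/

section EigenvalueLaw

variable {N : ℕ}

/-- Finite measures on the unit cube are determined by their polynomial moments. -/
lemma measure_ext_of_integral_mvPolynomial {ν₁ ν₂ : Measure (Fin N → ℝ)} [IsFiniteMeasure ν₁]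
    [IsFiniteMeasure ν₂] (h₁ : ∀ᵐ x ∂ν₁, x ∈ Set.Icc (0 : Fin N → ℝ) 1)
    (h₂ : ∀ᵐ x ∂ν₂, x ∈ Set.Icc (0 : Fin N → ℝ) 1)
    (h : ∀ f : MvPolynomial (Fin N) ℝ,
      ∫ x, MvPolynomial.eval x f ∂ν₁ = ∫ x, MvPolynomial.eval x f ∂ν₂) : ν₁ = ν₂ := by
  refine ext_of_forall_integral_eq_of_IsFiniteMeasure fun g => ?_
  let Φ : MvPolynomial (Fin N) ℝ →ₐ[ℝ] C(Fin N → ℝ, ℝ) :=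
    MvPolynomial.aeval fun i => ⟨fun x => x i, continuous_apply i⟩
  have hΦ : ∀ (f : MvPolynomial (Fin N) ℝ) (x : Fin N → ℝ), Φ f x = MvPolynomial.eval x f := by
    intro f x
    have : (ContinuousMap.evalAlgHom ℝ ℝ x).comp Φ = MvPolynomial.aeval x := by
      ext i; simp [Φ]
    have := DFunLike.congr_fun this f
    simpa [MvPolynomial.aeval_eq_eval] using this
  have hsep : Φ.range.SeparatesPoints := by
    intro x y hxy
    obtain ⟨i, hi⟩ := Function.ne_iff.1 hxy
    exact ⟨_, ⟨Φ (MvPolynomial.X i), ⟨_, rfl⟩, rfl⟩, by simpa [hΦ] using hi⟩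
  have key : ∀ (ν : Measure (Fin N → ℝ)) [IsFiniteMeasure ν],
      (∀ᵐ x ∂ν, x ∈ Set.Icc (0 : Fin N → ℝ) 1) → ∀ (f : MvPolynomial (Fin N) ℝ) (ε : ℝ),
      (∀ x ∈ Set.Icc (0 : Fin N → ℝ) 1, ‖MvPolynomial.eval x f - g x‖ ≤ ε) →
      ‖∫ x, MvPolynomial.eval x f ∂ν - ∫ x, g x ∂ν‖ ≤ ε * ν.real Set.univ := by
    intro ν _ hν f ε hf
    have hc := MvPolynomial.continuous_eval f
    obtain ⟨C, hC⟩ := (isCompact_Icc (a := (0 : Fin N → ℝ)) (b := 1)).exists_bound_of_continuousOn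
      hc.continuousOn
    have hi : Integrable (fun x => MvPolynomial.eval x f) ν :=
      Integrable.of_bound hc.aestronglyMeasurable C (hν.mono fun x hx => hC x hx)
    rw [← integral_sub hi (g.integrable ν)]
    exact norm_integral_le_of_norm_le_const (hν.mono fun x hx => hf x hx)
  refine eq_of_forall_dist_le fun ε hε => ?_
  -- Uniform error ε / T costs at most ε over the two masses together; the summand 1 keeps T
  -- positive when both measures vanish.
  set T := ν₁.real Set.univ + ν₂.real Set.univ + 1 with hT
  have hT0 : 0 < T := by positivity
  obtain ⟨_, ⟨f, rfl⟩, hf⟩ :=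
    ContinuousMap.exists_mem_subalgebra_near_continuous_of_isCompact_of_separatesPoints hsep
      g.toContinuousMap (isCompact_Icc (a := (0 : Fin N → ℝ)) (b := 1)) (div_pos hε hT0)
  have hf' : ∀ x ∈ Set.Icc (0 : Fin N → ℝ) 1, ‖MvPolynomial.eval x f - g x‖ ≤ ε / T := by
    intro x hx
    rw [← hΦ]
    exact (hf x hx).le
  have k1 := key ν₁ h₁ f _ hf'
  have k2 := key ν₂ h₂ f _ hf'
  rw [h f] at k1
  have hsum : ε / T * ν₁.real Set.univ + ε / T * ν₂.real Set.univ ≤ ε := by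
    rw [← mul_add, div_mul_eq_mul_div, div_le_iff₀ hT0]
    exact mul_le_mul_of_nonneg_left (by linarith) hε.le
  calc dist (∫ x, g x ∂ν₁) (∫ x, g x ∂ν₂) ≤
        dist (∫ x, MvPolynomial.eval x f ∂ν₂) (∫ x, g x ∂ν₁) +
        dist (∫ x, MvPolynomial.eval x f ∂ν₂) (∫ x, g x ∂ν₂) := dist_triangle_left _ _ _
    _ ≤ _ := add_le_add k1 k2
    _ ≤ ε := hsum

lemma eval_vdm (x : Fin N → ℝ) :
    MvPolynomial.eval x (vdm N) = (Matrix.vandermonde x).det := by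
  simp [vdm, Matrix.det_vandermonde]

lemma isSymmetric_vdm_sq : (vdm N ^ 2).IsSymmetric := by
  intro π
  refine MvPolynomial.funext fun x => ?_
  rw [MvPolynomial.eval_rename, map_pow, map_pow, eval_vdm, eval_vdm]
  have : Matrix.vandermonde (x ∘ π) = (Matrix.vandermonde x).submatrix π id := by
    ext i j; simp [Matrix.vandermonde]
  rw [this, Matrix.det_permute, mul_pow]
  rcases Int.units_eq_one_or (Equiv.Perm.sign π) with h | h <;> simp [h]

lemma cubeIntegral_rename (π : Equiv.Perm (Fin N)) (f : MvPolynomial (Fin N) ℝ) :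
    cubeIntegral N (MvPolynomial.rename π f) = cubeIntegral N f := by
  induction f using MvPolynomial.induction_on' with
  | monomial s c =>
    rw [MvPolynomial.rename_monomial, cubeIntegral_monomial, cubeIntegral_monomial,
      ← Equiv.prod_comp π fun i => ((Finsupp.mapDomain π s i : ℝ) + 1)⁻¹]
    simp only [Finsupp.mapDomain_apply π.injective]
  | add p q hp hq => rw [map_add, map_add, map_add, hp, hq]

/-- The symmetrization of a polynomial. -/
def symmetrization (f : MvPolynomial (Fin N) ℝ) : MvPolynomial (Fin N) ℝ :=
  (N ! : ℝ)⁻¹ • ∑ π : Equiv.Perm (Fin N), MvPolynomial.rename π f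

lemma isSymmetric_symmetrization (f : MvPolynomial (Fin N) ℝ) :
    (symmetrization f).IsSymmetric := by
  intro σ
  rw [symmetrization, map_smul, map_sum]
  congr 1
  simp only [MvPolynomial.rename_rename]
  exact Fintype.sum_equiv (Equiv.mulLeft σ) _ _ fun π => rfl

/-- Permuting coordinates preserves both the cube and the squared Vandermonde, so every permuted
copy of f contributes equally. -/
lemma cubeIntegral_symmetrization (f : MvPolynomial (Fin N) ℝ) :
    cubeIntegral N (symmetrization f * vdm N ^ 2) = cubeIntegral N (f * vdm N ^ 2) := by
  have h : ∀ π : Equiv.Perm (Fin N), cubeIntegral N (MvPolynomial.rename π f * vdm N ^ 2) =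
      cubeIntegral N (f * vdm N ^ 2) := by
    intro π
    rw [← cubeIntegral_rename π (f * vdm N ^ 2), map_mul (MvPolynomial.rename π), isSymmetric_vdm_sq π]
  have hN : (N ! : ℝ) ≠ 0 := by exact_mod_cast Nat.factorial_ne_zero N
  rw [symmetrization, smul_mul_assoc, map_smul, Finset.sum_mul, map_sum]
  simp [h, Fintype.card_perm, hN]

/-- The normalization constant of the joint eigenvalue density. -/
def densityConstant (N : ℕ) : ℝ :=
  (N ! : ℝ)⁻¹ * ∏ i : Fin N, (unitIntegral (monicLegendre i * monicLegendre i))⁻¹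

/-- With as many points as polynomials the kernel matrix factors as B D Bᵀ with B square. As B
evaluates monic polynomials of degrees 0, …, N-1, column operations reduce its determinant to the
Vandermonde determinant. -/
lemma determinantalDensity_eq_vdm (x : Fin N → ℝ) :
    determinantalDensity N (legendreKernel N) x =
      densityConstant N * MvPolynomial.eval x (vdm N ^ 2) := by
  let B : Matrix (Fin N) (Fin N) ℝ := Matrix.of fun i j : Fin N => (monicLegendre j).eval (x i)
  have hB : B.det = MvPolynomial.eval x (vdm N) := by
    rw [eval_vdm, Matrix.det_eval_matrixOfPolynomials_eq_det_vandermonde x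
      (fun i : Fin N => monicLegendre i) (fun i => natDegree_monicLegendre i)
      (fun i => monic_monicLegendre i)]
  have e : kernelMatrix N x = B * Matrix.diagonal (fun i : Fin N =>
      (unitIntegral (monicLegendre i * monicLegendre i))⁻¹) * B.transpose := by
    ext j k
    rw [Matrix.mul_apply]
    simp only [kernelMatrix, Matrix.of_apply, ← kernel_monicLegendre, kernel, weight_two, one_mul,
      Matrix.mul_diagonal, Matrix.transpose_apply, B, weightedInner_eq, one_div]
    exact Finset.sum_congr rfl fun i _ => by ring
  rw [determinantalDensity_eq, e, Matrix.det_mul, Matrix.det_mul, Matrix.det_transpose,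
    Matrix.det_diagonal, hB, Nat.sub_self, Nat.factorial_zero, Nat.cast_one, one_div, map_pow,
    densityConstant]
  ring

lemma integral_determinantalMeasure (f : MvPolynomial (Fin N) ℝ) :
    ∫ x, MvPolynomial.eval x f ∂determinantalMeasure N N =
      densityConstant N * cubeIntegral N (f * vdm N ^ 2) := by
  rw [determinantalMeasure, integral_withDensity_eq_integral_toReal_smul
    (measurable_ofReal_determinantalDensity N N) (ae_of_all _ fun x => ENNReal.ofReal_lt_top)]
  change _ = densityConstant N * ∫ x in Set.Icc (0 : Fin N → ℝ) 1,
    MvPolynomial.eval x (f * vdm N ^ 2)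
  rw [← integral_const_mul]
  refine integral_congr_ae (ae_of_all _ fun x => ?_)
  dsimp only
  rw [ENNReal.toReal_ofReal (determinantalDensity_nonneg N x), determinantalDensity_eq_vdm,
    smul_eq_mul, map_mul]
  ring

/-- The constant is read off from the total mass 1 of the determinantal measure. -/
lemma densityConstant_mul (N : ℕ) : densityConstant N * cubeIntegral N (vdm N ^ 2) = 1 := by
  have := isProbabilityMeasure_determinantalMeasure N
  have h := integral_determinantalMeasure (1 : MvPolynomial (Fin N) ℝ)
  simpa using h.symm

lemma measurable_eigenvalues_perm (π : Equiv.Perm (Fin N)) :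
    Measurable fun (U : Matrix.unitaryGroup (Fin 2 × Fin N) ℂ) i => eigenvalues U (π i) :=
  measurable_pi_lambda _ fun i => (measurable_pi_apply (π i)).comp measurable_eigenvalues

lemma ae_mem_Icc_eigenvalueLaw (μ : Measure (Matrix.unitaryGroup (Fin 2 × Fin N) ℂ)) :
    ∀ᵐ x ∂eigenvalueLaw μ, x ∈ Set.Icc (0 : Fin N → ℝ) 1 := by
  rw [eigenvalueLaw]
  refine Measure.ae_smul_measure ?_ _
  rw [← Measure.sum_fintype]
  refine (Measure.ae_sum_iff' measurableSet_Icc).2 fun π => ?_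
  refine (ae_map_iff (measurable_eigenvalues_perm π).aemeasurable measurableSet_Icc).2
    (ae_of_all _ fun U => ?_)
  exact ⟨fun i => (eigenvalues_mem_Icc U).1 (π i), fun i => (eigenvalues_mem_Icc U).2 (π i)⟩

variable (μ : Measure (Matrix.unitaryGroup (Fin 2 × Fin N) ℂ)) [IsProbabilityMeasure μ]

instance isFiniteMeasure_eigenvalueLaw : IsFiniteMeasure (eigenvalueLaw μ) := by
  constructor
  have h : ∀ π : Equiv.Perm (Fin N),
      (μ.map fun U i => eigenvalues U (π i)) Set.univ = 1 := fun π => by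
    rw [Measure.map_apply (measurable_eigenvalues_perm π) MeasurableSet.univ, Set.preimage_univ,
      measure_univ]
  rw [eigenvalueLaw, Measure.smul_apply, Measure.finsetSum_apply]
  simp only [h, smul_eq_mul]
  exact ENNReal.mul_lt_top (ENNReal.inv_lt_top.2 (by exact_mod_cast Nat.factorial_pos N))
    (by simp)

/-- The random labeling of the eigenvalues becomes symmetrization of the test polynomial, which
brings any f within reach of the symmetric theory. -/
lemma integral_eigenvalueLaw (f : MvPolynomial (Fin N) ℝ) :
    ∫ x, MvPolynomial.eval x f ∂eigenvalueLaw μ = haarFunctional μ (symmetrization f) := by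
  have e : ∀ (π : Equiv.Perm (Fin N)) (U : Matrix.unitaryGroup (Fin 2 × Fin N) ℂ),
      MvPolynomial.eval (fun i => eigenvalues U (π i)) f =
        MvPolynomial.eval (eigenvalues U) (MvPolynomial.rename π f) := fun π U => by
    rw [MvPolynomial.eval_rename]; rfl
  rw [eigenvalueLaw, integral_smul_measure, integral_finsetSum_measure, symmetrization, map_smul,
    map_sum]
  · congr 1
    · simp
    · refine Finset.sum_congr rfl fun π _ => ?_
      rw [integral_map (measurable_eigenvalues_perm π).aemeasurable
        (MvPolynomial.continuous_eval f).aestronglyMeasurable]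
      simp only [e]
      rfl
  · intro π _
    rw [integrable_map_measure (MvPolynomial.continuous_eval f).aestronglyMeasurable
      (measurable_eigenvalues_perm π).aemeasurable]
    simp only [Function.comp_def, e]
    exact integrable_eval_eigenvalues μ _

theorem eigenvalueLaw_eq [μ.IsMulLeftInvariant] :
    eigenvalueLaw μ = determinantalMeasure N N := by
  have := isProbabilityMeasure_determinantalMeasure N
  refine measure_ext_of_integral_mvPolynomial (ae_mem_Icc_eigenvalueLaw μ) ?_ fun f => ?_
  · exact (withDensity_absolutelyContinuous _ _).ae_le (ae_restrict_mem measurableSet_Icc)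
  · rw [integral_eigenvalueLaw, integral_determinantalMeasure,
      haarFunctional_eq μ (densityConstant_mul N) (isSymmetric_symmetrization f),
      cubeIntegral_symmetrization]

theorem eigenvalueMarginal_eq [μ.IsMulLeftInvariant] {ℓ : ℕ} (hℓ : ℓ ≤ N) :
    eigenvalueMarginal μ hℓ = determinantalMeasure N ℓ := by
  rw [eigenvalueMarginal, eigenvalueLaw_eq, map_castLE_determinantalMeasure]

end EigenvalueLaw

end BlockEncoding

end

theorem mainTheorem11 (N : ℕ)
    (μ : MeasureTheory.Measure (Matrix.unitaryGroup (Fin 2 × Fin N) ℂ))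
    [μ.IsHaarMeasure] [MeasureTheory.IsProbabilityMeasure μ] :
    (∀ x : ℝ, BlockEncoding.weight N 2 x = 1) ∧
    (∃ C : Fin N → Polynomial ℝ,
      BlockEncoding.IsMonicOrthogonal (BlockEncoding.weight N 2) C) ∧
    (∀ C : Fin N → Polynomial ℝ,
      BlockEncoding.IsMonicOrthogonal (BlockEncoding.weight N 2) C →
        ∀ x y : ℝ, BlockEncoding.kernel (BlockEncoding.weight N 2) C x y =
          BlockEncoding.legendreKernel N x y) ∧
    (∀ (ℓ : ℕ) (hℓ : ℓ ≤ N),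
      (∀ x : Fin ℓ → ℝ, 0 ≤
        BlockEncoding.determinantalDensity N (BlockEncoding.legendreKernel N) x) ∧
      BlockEncoding.eigenvalueMarginal μ hℓ =
        (MeasureTheory.volume.restrict (Set.Icc (0 : Fin ℓ → ℝ) 1)).withDensity (fun x =>
          ENNReal.ofReal
            (BlockEncoding.determinantalDensity N (BlockEncoding.legendreKernel N) x))) := by
  refine ⟨BlockEncoding.weight_two N, ⟨_, BlockEncoding.isMonicOrthogonal_monicLegendre N⟩,
    fun C hC => BlockEncoding.kernel_eq hC, fun ℓ hℓ =>
      ⟨BlockEncoding.determinantalDensity_nonneg N, BlockEncoding.eigenvalueMarginal_eq μ hℓ⟩⟩
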